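/- Let $(\Omega,\mathcal F,\mathbb P)$ be an atomless probability space and let $\mathcal U$ be the set of random variables on it that are uniform on $[0,1]$. Fix an integer $K\ge 1$. Let $\mathcal C(x)=\frac1\pi\arctan x+\frac12$ be the standard Cauchy distribution function, $\mathcal C^{-1}(p)=\tan(\pi(p-\frac12))$, and put $$M_{\mathcal C,K}(p_1,\dots,p_K)=\mathcal C\Big(\frac1K\sum_{i=1}^K\mathcal C^{-1}(p_i)\Big),\qquad M_{r,K}(p_1,\dots,p_K)=\Big(\frac{p_1^r+\dots+p_K^r}{K}\Big)^{1/r}\quad(r\in\mathbb R\setminus\{0\}),$$ with $M_{-\infty,K}=\min_i p_i$, $M_{0,K}=(\prod_i p_i)^{1/K}$, $M_{\infty,K}=\max_i p_i$ (at boundary points of $[0,1]^K$, which are immaterial for the probabilistic statements, limiting values are used). For a random variable $X$ let $q_\epsilon(X)=\inf\{x\in\mathbb R:\mathbb P(X\le x)\ge\epsilon\}$. For $F=M_{\mathcal C,K}$ or $F=M_{-1,K}$ and $\epsilon\in(0,1)$ let $$a_F(\epsilon)=\inf\{q_\epsilon(F(U_1,\dots,U_K)) : U_1,\dots,U_K\in\mathcal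 U\},\qquad b_F(\epsilon)=q_\epsilon(F(V_1,\dots,V_K)),$$ where $V_1,\dots,V_K$ are independent and uniform on $[0,1]$. Write $a_{\mathcal C},b_{\mathcal C}$ for $F=M_{\mathcal C,K}$ and $a_{\mathcal H},b_{\mathcal H}$ for $F=M_{-1,K}$. As usual, $f(\epsilon)\sim g(\epsilon)$ means $f(\epsilon)/g(\epsilon)\to1$. Then: (i) For every fixed $c\in(0,1)$, $\dfrac{M_{\mathcal C,K}(p_1,\dots,p_K)}{M_{-1,K}(p_1,\dots,p_K)}\to1$ as $\min_i p_i\downarrow0$ subject to $p_i>0$ and $\max_i p_i\le c$. (ii) Let $U_1,\dots,U_K\in\mathcal U$ be such that for all $i<j$ the pair $(U_i,U_j)$ follows a bivariate Gaussian copula with some correlation $\rho_{ij}\in[-1,1]$, that is, it has the law of $(\Phi(X),\Phi(Y))$, where $\Phi$ is the standard normal distribution function and $(X,Y)$ is jointly Gaussian (possibly degenerate) with standard normal marginals and covariance $\rho_{ij}$. Then $\mathbb P(M_{-1,K}(U_1,\dots,U_K)<\epsilon)\sim\epsilon$ as $\epsilon\downarrow0$. If moreover $\rho_{ij}>-1$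 for all $i<j$, then $$\mathbb P(M_{\mathcal C,K}(U_1,\dots,U_K)<\epsilon)\sim\mathbb P(M_{-1,K}(U_1,\dots,U_K)<\epsilon)\sim\epsilon\quad\text{as }\epsilon\downarrow0.$$ In particular, $b_{\mathcal C}(\epsilon)\sim b_{\mathcal H}(\epsilon)$ as $\epsilon\downarrow0$. (iii) $a_{\mathcal C}(\epsilon)\sim a_{\mathcal H}(\epsilon)$ as $\epsilon\downarrow0$. (iv) If $K\ge2$, then for every $r\in[-\infty,\infty]$ with $r\ne-1$, the ratio $\dfrac{M_{\mathcal C,K}(p_1,\dots,p_K)}{M_{r,K}(p_1,\dots,p_K)}$ does not converge to $1$ as $\max_i p_i\downarrow0$ with all $p_i>0$. -/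

import Mathlib

open MeasureTheory ProbabilityTheory Filter Topology Asymptotics

noncomputable section

namespace PValueMerging

/-- The standard Cauchy distribution function. -/
def cauchyCDF (x : ℝ) : ℝ := Real.arctan x / Real.pi + 1 / 2

/-- The standard Cauchy quantile function, used on `(0, 1)`. -/
def cauchyQuantile (p : ℝ) : ℝ := Real.tan (Real.pi * (p - 1 / 2))

open Classical in
/-- The Cauchy combining function `M_{C,K}` on `[0,1]^K`.  On `(0,1)^K` it is given by the last
line; on the boundary (a null set for uniform variables) the Cauchy quantiles are infinite and the
value is the limiting one: `0` if some coordinate is `0`, else `1` if some coordinate is `1`. -/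
def cauchyMean {K : ℕ} (p : Fin K → ℝ) : ℝ :=
  if ∃ i, p i = 0 then 0
  else if ∃ i, p i = 1 then 1
  else cauchyCDF ((∑ i, cauchyQuantile (p i)) / K)

open Classical in
/-- The averaging functions `M_{r,K}`, `r ∈ [-∞, ∞]`: minimum for `r = -∞`, maximum for `r = ∞`,
geometric mean for `r = 0`, and `((p₁ ^ r + ⋯ + p_K ^ r) / K) ^ (1 / r)` otherwise, with the
convention `0 ^ r = ∞` and `∞ ^ (1 / r) = 0` for `r < 0`. -/
def powerMean {K : ℕ} (r : EReal) (p : Fin K → ℝ) : ℝ :=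
  if r = ⊥ then ⨅ i, p i
  else if r = ⊤ then ⨆ i, p i
  else if r = 0 then (∏ i, p i) ^ (1 / (K : ℝ))
  else if r < 0 ∧ ∃ i, p i = 0 then 0
  else ((∑ i, p i ^ r.toReal) / K) ^ (1 / r.toReal)

/-- The harmonic averaging function `M_{-1,K}`. -/
def harmonicMean {K : ℕ} (p : Fin K → ℝ) : ℝ := powerMean (-1) p

/-- A measure is atomless if every measurable set of positive measure has a measurable subset of
strictly smaller positive measure. -/
def IsAtomless {Ω : Type*} [MeasurableSpace Ω] (P : Measure Ω) : Prop :=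
  ∀ A : Set Ω, MeasurableSet A → 0 < P A →
    ∃ B : Set Ω, B ⊆ A ∧ MeasurableSet B ∧ 0 < P B ∧ P B < P A

/-- Standard uniform random variables on the probability space `(Ω, P)`. -/
def IsStdUniform {Ω : Type*} [MeasurableSpace Ω] (P : Measure Ω) (U : Ω → ℝ) : Prop :=
  Measurable U ∧ pdf.IsUniform U (Set.Icc (0 : ℝ) 1) P

/-- The left `ε`-quantile `inf {x | P (X ≤ x) ≥ ε}`. -/
def leftQuantile {Ω : Type*} [MeasurableSpace Ω] (P : Measure Ω) (X : Ω → ℝ) (ε : ℝ) : ℝ :=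
  sInf {x : ℝ | ε ≤ P.real {ω | X ω ≤ x}}

/-- The threshold `a_F(ε)` for arbitrary dependence: the infimum of the `ε`-quantiles of
`F(U₁, …, U_K)` over all standard uniform `U₁, …, U_K` on `(Ω, P)`. -/
def thresholdArbitrary {Ω : Type*} [MeasurableSpace Ω] (P : Measure Ω) {K : ℕ}
    (F : (Fin K → ℝ) → ℝ) (ε : ℝ) : ℝ :=
  sInf {q : ℝ | ∃ U : Fin K → Ω → ℝ, (∀ i, IsStdUniform P (U i)) ∧
    q = leftQuantile P (fun ω => F (fun i => U i ω)) ε}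

/-- The law of `K` independent standard uniform random variables. -/
def iidUniform (K : ℕ) : Measure (Fin K → ℝ) :=
  Measure.pi fun _ => (volume : Measure ℝ).restrict (Set.Icc 0 1)

/-- The threshold `b_F(ε)` for independence: the `ε`-quantile of `F(V₁, …, V_K)` for independent
standard uniform `V₁, …, V_K` (taken as the coordinates on the product space). -/
def thresholdIndep {K : ℕ} (F : (Fin K → ℝ) → ℝ) (ε : ℝ) : ℝ :=
  leftQuantile (iidUniform K) F ε

/-- The standard normal distribution function. -/
def stdNormalCDF (x : ℝ) : ℝ := cdf (gaussianReal 0 1) x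

/-- The bivariate Gaussian copula with correlation `ρ`: the law of `(Φ(X), Φ(Y))` with `(X, Y)`
jointly Gaussian (possibly degenerate), standard normal marginals and covariance `ρ`. -/
def IsGaussianCopula (ρ : ℝ) (C : Measure (ℝ × ℝ)) : Prop :=
  ∃ ν : Measure (ℝ × ℝ), IsGaussian ν ∧
    ν.map Prod.fst = gaussianReal 0 1 ∧ ν.map Prod.snd = gaussianReal 0 1 ∧
    covariance Prod.fst Prod.snd ν = ρ ∧
    C = ν.map (Prod.map stdNormalCDF stdNormalCDF)

/-- Condition (G): every pair `(U_i, U_j)`, `i < j`, follows a bivariate Gaussian copula, with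
correlation `ρ i j`. -/
def PairwiseGaussianCopula {Ω : Type*} [MeasurableSpace Ω] (P : Measure Ω) {K : ℕ}
    (ρ : Fin K → Fin K → ℝ) (U : Fin K → Ω → ℝ) : Prop :=
  ∀ i j : Fin K, i < j → IsGaussianCopula (ρ i j) (P.map fun ω => (U i ω, U j ω))

end PValueMerging

end

namespace PValueMerging

/-! Part (i). The Cauchy quantile is `-cot (π p)`, which on `(0, c]` differs from `-1 / (π p)` by a
nonnegative bounded amount. Averaging over the coordinates gives `-1 / (π H) + O(1)`, with `H` the
harmonic mean, and a bounded shift is invisible to the Cauchy distribution function in its left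
tail: `cauchyCDF (B - 1 / (π h)) / h → 1` for every `B`. Hence the Cauchy mean is squeezed between
two functions of `H` that are both asymptotic to `H`.

Part (ii). Smallness of the harmonic mean says that `∑ 1 / U i` is large, smallness of the Cauchy
mean that `∑ -cauchyQuantile (U i)` is large. The summands have tails `1 / x` and `1 / (π x)` to
first order, and such a sum is large essentially because one summand is, provided that two are not
large together at the same scale (`tendsto_mul_tail_sum`). Summands that coincide almost surely are
merged into one with a multiplicity; since the tail index is `-1`, a weight `m` multiplies the tail
by exactly `m`, so the total is the same as without ties. For a Gaussian pair with `ρ < 1`, both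
coordinates below `-t` force `X + Y ≤ -2 t`, where `X + Y` has variance `2 + 2 ρ < 4`; this is
negligible against the normal tail at `-t`. For the Cauchy sum a very negative term could cancel a
large one; this is excluded by the same argument for `X - Y`, which needs `ρ > -1`. Independence
satisfies the same conditions because joint corner probabilities are `u * u`.

Part (iii). A threshold for arbitrary dependence only sees an event of probability `ε`. Re-ranking
each variable inside that event keeps it uniform, lowers its values there and puts them all below
`ε` (`rearrange`), where the comparison of part (i) holds with a constant close to `1`. This gives
inequalities between the thresholds in both directions (`thresholdArbitrary_le_mul`).

Part (iv). Power means are homogeneous, so equivalence with the Cauchy mean near the origin, read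
along a ray and compared with part (i), would force equality with the harmonic mean at every
positive vector. Vectors of the form `(x, 1, …, 1)` refute this unless `r = -1`. -/

/-! ### Elementary estimates: the Cauchy mean against the harmonic mean -/

lemma cauchyCDF_strictMono : StrictMono cauchyCDF := fun x y h => by
  have := Real.arctan_strictMono h
  have hp := Real.pi_pos
  unfold cauchyCDF
  gcongr

lemma cauchyCDF_nonneg (x : ℝ) : 0 ≤ cauchyCDF x := by
  have h := Real.neg_pi_div_two_lt_arctan x
  have hp := Real.pi_pos
  unfold cauchyCDF
  have : -(1 / 2) ≤ Real.arctan x / Real.pi := by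
    rw [le_div_iff₀ hp]; linarith
  linarith

lemma cauchyCDF_le_one (x : ℝ) : cauchyCDF x ≤ 1 := by
  have h := Real.arctan_lt_pi_div_two x
  have hp := Real.pi_pos
  unfold cauchyCDF
  have : Real.arctan x / Real.pi ≤ 1 / 2 := by
    rw [div_le_iff₀ hp]; linarith
  linarith

lemma cauchyQuantile_strictMonoOn : StrictMonoOn cauchyQuantile (Set.Ioo 0 1) := by
  intro x hx y hy h
  have hp := Real.pi_pos
  refine Real.strictMonoOn_tan ⟨?_, ?_⟩ ⟨?_, ?_⟩ ?_
  · nlinarith [hx.1]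
  · nlinarith [hx.2]
  · nlinarith [hy.1]
  · nlinarith [hy.2]
  · nlinarith

lemma cauchyCDF_cauchyQuantile {p : ℝ} (hp0 : 0 < p) (hp1 : p < 1) :
    cauchyCDF (cauchyQuantile p) = p := by
  have hp := Real.pi_pos
  unfold cauchyCDF cauchyQuantile
  rw [Real.arctan_tan (by nlinarith) (by nlinarith)]
  field_simp
  ring

lemma cauchyQuantile_eq (p : ℝ) : cauchyQuantile p = -(Real.tan (Real.pi * p))⁻¹ := by
  unfold cauchyQuantile
  rw [← Real.tan_pi_div_two_sub, ← Real.tan_neg]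
  congr 1
  ring

lemma cauchyQuantile_one_sub (p : ℝ) : cauchyQuantile (1 - p) = -cauchyQuantile p := by
  unfold cauchyQuantile
  rw [← Real.tan_neg]
  congr 1
  ring

lemma cauchyCDF_neg {y : ℝ} (hy : 0 < y) : cauchyCDF (-y) = Real.arctan y⁻¹ / Real.pi := by
  have hp := Real.pi_pos
  unfold cauchyCDF
  rw [Real.arctan_inv_of_pos hy, Real.arctan_neg]
  field_simp
  ring

lemma cauchyMean_eq {K : ℕ} {p : Fin K → ℝ} (h0 : ∀ i, 0 < p i) (h1 : ∀ i, p i < 1) :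
    cauchyMean p = cauchyCDF ((∑ i, cauchyQuantile (p i)) / K) := by
  unfold cauchyMean
  rw [if_neg, if_neg]
  · rintro ⟨i, hi⟩; exact (h1 i).ne hi
  · rintro ⟨i, hi⟩; exact (h0 i).ne' hi

lemma cauchyMean_nonneg {K : ℕ} (p : Fin K → ℝ) : 0 ≤ cauchyMean p := by
  unfold cauchyMean
  split_ifs
  · rfl
  · exact zero_le_one
  · exact cauchyCDF_nonneg _

lemma harmonicMean_eq {K : ℕ} {p : Fin K → ℝ} (h0 : ∀ i, 0 < p i) :
    harmonicMean p = ((∑ i, (p i)⁻¹) / K)⁻¹ := by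
  unfold harmonicMean powerMean
  have h1 : ¬ ∃ i, p i = 0 := by rintro ⟨i, hi⟩; exact (h0 i).ne' hi
  have e : (-1 : EReal).toReal = -1 := by simp
  have e1 : (-1 : EReal) ≠ ⊥ := by decide
  have e2 : (-1 : EReal) ≠ ⊤ := by decide
  have e3 : (-1 : EReal) ≠ 0 := by simp
  rw [if_neg e1, if_neg e2, if_neg e3, if_neg (fun h => h1 h.2), e]
  simp [Real.rpow_neg_one]

lemma harmonicMean_pos {K : ℕ} (hK : 1 ≤ K) {p : Fin K → ℝ} (h0 : ∀ i, 0 < p i) :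
    0 < harmonicMean p := by
  rw [harmonicMean_eq h0]
  have : Nonempty (Fin K) := ⟨⟨0, hK⟩⟩
  have hK' : (0 : ℝ) < K := by exact_mod_cast hK
  have := Finset.sum_pos (fun i (_ : i ∈ Finset.univ) => inv_pos.2 (h0 i)) Finset.univ_nonempty
  positivity

lemma harmonicMean_le_mul {K : ℕ} (hK : 1 ≤ K) {p : Fin K → ℝ} (h0 : ∀ i, 0 < p i) (i : Fin K) :
    harmonicMean p ≤ K * p i := by
  rw [harmonicMean_eq h0]
  have hK' : (0 : ℝ) < K := by exact_mod_cast hK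
  have h : (p i)⁻¹ ≤ ∑ i, (p i)⁻¹ :=
    Finset.single_le_sum (f := fun i => (p i)⁻¹) (fun j _ => (inv_pos.2 (h0 j)).le)
      (Finset.mem_univ i)
  have h2 := inv_pos.2 (h0 i)
  calc ((∑ i, (p i)⁻¹) / K)⁻¹ ≤ ((p i)⁻¹ / K)⁻¹ := by gcongr
    _ = K * p i := by field_simp

lemma harmonicMean_mono {K : ℕ} (hK : 1 ≤ K) {p q : Fin K → ℝ} (h0 : ∀ i, 0 < p i)
    (h : ∀ i, p i ≤ q i) : harmonicMean p ≤ harmonicMean q := by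
  have hq : ∀ i, 0 < q i := fun i => (h0 i).trans_le (h i)
  rw [harmonicMean_eq h0, harmonicMean_eq hq]
  have : Nonempty (Fin K) := ⟨⟨0, hK⟩⟩
  have hK' : (0 : ℝ) < K := by exact_mod_cast hK
  have := Finset.sum_pos (fun i (_ : i ∈ Finset.univ) => inv_pos.2 (hq i)) Finset.univ_nonempty
  gcongr with i
  · exact h0 i
  · exact h i

lemma cauchyMean_mono {K : ℕ} {p q : Fin K → ℝ} (h0 : ∀ i, 0 < p i)
    (h : ∀ i, p i ≤ q i) (h1 : ∀ i, q i < 1) : cauchyMean p ≤ cauchyMean q := by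
  have hq : ∀ i, 0 < q i := fun i => (h0 i).trans_le (h i)
  rw [cauchyMean_eq h0 (fun i => (h i).trans_lt (h1 i)), cauchyMean_eq hq h1]
  apply cauchyCDF_strictMono.monotone
  gcongr with i
  exact cauchyQuantile_strictMonoOn.monotoneOn ⟨h0 i, (h i).trans_lt (h1 i)⟩ ⟨hq i, h1 i⟩ (h i)

/-- Below `1 / 2` this is `x < tan x`; from `1 / 2` on the quantile is nonnegative. The bound is
uniform up to `1`, so it also controls the tails of uniform variables later. -/
lemma neg_inv_le_cauchyQuantile {p : ℝ} (h0 : 0 < p) (h1 : p < 1) :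
    -(Real.pi * p)⁻¹ ≤ cauchyQuantile p := by
  have hp := Real.pi_pos
  have hx : 0 < Real.pi * p := by positivity
  rcases lt_or_ge p (1 / 2) with h | h
  · rw [cauchyQuantile_eq]
    have := Real.lt_tan hx (by nlinarith)
    gcongr
  · have : 0 ≤ cauchyQuantile p :=
      Real.tan_nonneg_of_nonneg_of_le_pi_div_two (by nlinarith) (by nlinarith)
    have : 0 ≤ (Real.pi * p)⁻¹ := by positivity
    linarith

/-- Near `0` the bound `cot x ≥ 1 / x - x / 2` suffices. Once `π p > 1`, the reciprocal is at most
`1` and monotonicity bounds the quantile by its value at `c`; the constant covers both ranges. -/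
lemma cauchyQuantile_add_inv_le {p c : ℝ} (h0 : 0 < p) (hpc : p ≤ c) (h1 : c < 1) :
    cauchyQuantile p + (Real.pi * p)⁻¹ ≤ |cauchyQuantile c| + 1 := by
  have hp := Real.pi_pos
  have hx : 0 < Real.pi * p := by positivity
  rcases le_or_gt (Real.pi * p) 1 with h | h
  · rw [cauchyQuantile_eq, Real.tan_eq_sin_div_cos, inv_div]
    set x := Real.pi * p
    have hs := Real.sin_pos_of_pos_of_le_one hx h
    have hc := Real.one_sub_sq_div_two_le_cos (x := x)
    have hs' := Real.sin_le hx.le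
    have : (1 - x ^ 2 / 2) / x ≤ Real.cos x / Real.sin x := by
      have : 0 ≤ 1 - x ^ 2 / 2 := by nlinarith
      gcongr
      linarith
    have e : (1 - x ^ 2 / 2) / x = x⁻¹ - x / 2 := by field_simp
    have := abs_nonneg (cauchyQuantile c)
    linarith
  · have := cauchyQuantile_strictMonoOn.monotoneOn ⟨h0, hpc.trans_lt h1⟩
      ⟨h0.trans_le hpc, h1⟩ hpc
    have h2 : (Real.pi * p)⁻¹ ≤ 1 := inv_le_one_of_one_le₀ h.le
    have := le_abs_self (cauchyQuantile c)
    linarith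

/-- For small `h > 0` the numerator equals `arctan (π h / (1 - π h B)) / π`, which is differentiable
at `0` with derivative `1` whatever `B` is. -/
lemma tendsto_cauchyCDF_sub_inv_div (B : ℝ) :
    Tendsto (fun h => cauchyCDF (B - (Real.pi * h)⁻¹) / h) (𝓝[>] 0) (𝓝 1) := by
  have hp := Real.pi_pos
  have hd : HasDerivAt (fun h => Real.arctan (Real.pi * h / (1 - Real.pi * h * B)) / Real.pi)
      1 0 := by
    have h1 : HasDerivAt (fun h : ℝ => Real.pi * h) Real.pi 0 := by
      simpa using (hasDerivAt_id (0 : ℝ)).const_mul Real.pi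
    have h2 : HasDerivAt (fun h : ℝ => 1 - Real.pi * h * B) (-(Real.pi * B)) 0 := by
      simpa using (h1.mul_const B).const_sub 1
    have := ((h1.div h2 (by simp)).arctan).div_const Real.pi
    refine this.congr_deriv ?_
    simp [hp.ne']
  have ht := hd.tendsto_slope_zero_right
  refine ht.congr' ?_
  have hev : ∀ᶠ h in 𝓝[>] (0 : ℝ), 0 < 1 - Real.pi * h * B := by
    have : Tendsto (fun h : ℝ => 1 - Real.pi * h * B) (𝓝[>] 0) (𝓝 (1 - Real.pi * 0 * B)) := by
      apply Continuous.tendsto' _ _ _ rfl |>.mono_left nhdsWithin_le_nhds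
      fun_prop
    exact this.eventually (lt_mem_nhds (by simp))
  filter_upwards [hev, self_mem_nhdsWithin] with h hh (hpos : 0 < h)
  have hy : 0 < (Real.pi * h)⁻¹ - B := by
    have : (Real.pi * h)⁻¹ - B = (1 - Real.pi * h * B) / (Real.pi * h) := by field_simp
    rw [this]; positivity
  have e : B - (Real.pi * h)⁻¹ = -((Real.pi * h)⁻¹ - B) := by ring
  rw [e, cauchyCDF_neg hy]
  simp
  field_simp

/-- The average of `1 / (π p i)` is `1 / (π H)` with `H` the harmonic mean, so the coordinatewise
bounds on the quantile average to these. -/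
lemma cauchyMean_bounds {K : ℕ} (hK : 1 ≤ K) {p : Fin K → ℝ} {c : ℝ} (h0 : ∀ i, 0 < p i)
    (hc : c < 1) (hpc : ∀ i, p i ≤ c) :
    cauchyCDF (0 - (Real.pi * harmonicMean p)⁻¹) ≤ cauchyMean p ∧
    cauchyMean p ≤ cauchyCDF ((|cauchyQuantile c| + 1) - (Real.pi * harmonicMean p)⁻¹) := by
  have hK' : (0 : ℝ) < K := by exact_mod_cast hK
  have h1 : ∀ i, p i < 1 := fun i => (hpc i).trans_lt hc
  rw [cauchyMean_eq h0 h1, cauchyCDF_strictMono.le_iff_le, cauchyCDF_strictMono.le_iff_le]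
  have e : (Real.pi * harmonicMean p)⁻¹ = (∑ i, (Real.pi * p i)⁻¹) / K := by
    rw [harmonicMean_eq h0, mul_inv, inv_inv, ← mul_div_assoc, Finset.mul_sum]
    simp_rw [mul_inv]
  rw [e]
  constructor
  · rw [zero_sub, ← neg_div, ← Finset.sum_neg_distrib]
    gcongr with i
    exact neg_inv_le_cauchyQuantile (h0 i) (h1 i)
  · rw [le_sub_iff_add_le, ← add_div, ← Finset.sum_add_distrib, div_le_iff₀ hK']
    calc _ ≤ ∑ i : Fin K, (|cauchyQuantile c| + 1) :=
          Finset.sum_le_sum fun i _ => cauchyQuantile_add_inv_le (h0 i) (hpc i) hc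
      _ = _ := by simp; ring

/-- The Cauchy and harmonic combining functions are equivalent near the part of the boundary where
the smallest coordinate vanishes and all coordinates stay away from `1`. -/
theorem tendsto_cauchyMean_div_harmonicMean {K : ℕ} (hK : 1 ≤ K) {c : ℝ} (hc : c < 1) :
    Tendsto (fun p : Fin K → ℝ => cauchyMean p / harmonicMean p)
      (comap (fun p => ⨅ i, p i) (𝓝[>] 0) ⊓ 𝓟 {p | ∀ i, p i ≤ c}) (𝓝 1) := by
  have : Nonempty (Fin K) := ⟨⟨0, hK⟩⟩
  have hK' : (0 : ℝ) < K := by exact_mod_cast hK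
  set l : Filter (Fin K → ℝ) := comap (fun p => ⨅ i, p i) (𝓝[>] 0) ⊓ 𝓟 {p | ∀ i, p i ≤ c}
  have hmin : Tendsto (fun p : Fin K → ℝ => ⨅ i, p i) l (𝓝[>] 0) :=
    tendsto_comap.mono_left inf_le_left
  have hpos : ∀ᶠ p in l, ∀ i, 0 < p i := by
    filter_upwards [hmin.eventually self_mem_nhdsWithin] with p (hp : 0 < ⨅ i, p i) i
    exact hp.trans_le (ciInf_le (Set.finite_range p).bddBelow i)
  have hle : ∀ᶠ p in l, ∀ i, p i ≤ c := eventually_inf_principal.2 (Eventually.of_forall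
    fun _ h => h)
  have hH : Tendsto (harmonicMean (K := K)) l (𝓝[>] 0) := by
    refine tendsto_nhdsWithin_iff.2 ⟨?_, ?_⟩
    · have h1 : Tendsto (fun p : Fin K → ℝ => K * ⨅ i, p i) l (𝓝 0) := by
        simpa using (hmin.mono_right nhdsWithin_le_nhds).const_mul (K : ℝ)
      refine tendsto_of_tendsto_of_tendsto_of_le_of_le' tendsto_const_nhds h1 ?_ ?_
      · filter_upwards [hpos] with p hp using (harmonicMean_pos hK hp).le
      · filter_upwards [hpos] with p hp
        obtain ⟨i, hi⟩ := exists_eq_ciInf_of_finite (f := p)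
        rw [← hi]
        exact harmonicMean_le_mul hK hp i
    · filter_upwards [hpos] with p hp using harmonicMean_pos hK hp
  refine tendsto_of_tendsto_of_tendsto_of_le_of_le'
    ((tendsto_cauchyCDF_sub_inv_div 0).comp hH)
    ((tendsto_cauchyCDF_sub_inv_div (|cauchyQuantile c| + 1)).comp hH) ?_ ?_
  · filter_upwards [hpos, hle] with p hp hpc
    exact div_le_div_of_nonneg_right (cauchyMean_bounds hK hp hc hpc).1 (harmonicMean_pos hK hp).le
  · filter_upwards [hpos, hle] with p hp hpc
    exact div_le_div_of_nonneg_right (cauchyMean_bounds hK hp hc hpc).2 (harmonicMean_pos hK hp).le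

/-! ### Uniqueness of the exponent `-1` -/

lemma powerMean_mul {K : ℕ} (hK : 1 ≤ K) (r : EReal) {t : ℝ} (ht : 0 < t) {v : Fin K → ℝ}
    (hv : ∀ i, 0 < v i) : powerMean r (fun i => t * v i) = t * powerMean r v := by
  have hK' : (K : ℝ) ≠ 0 := by positivity
  unfold powerMean
  have h1 : ¬ ∃ i, v i = 0 := by rintro ⟨i, hi⟩; exact (hv i).ne' hi
  have h2 : ¬ ∃ i, t * v i = 0 := by rintro ⟨i, hi⟩; exact (mul_pos ht (hv i)).ne' hi
  by_cases hb : r = ⊥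
  · rw [if_pos hb, if_pos hb, Real.mul_iInf_of_nonneg ht.le]
  rw [if_neg hb, if_neg hb]
  by_cases hT : r = ⊤
  · rw [if_pos hT, if_pos hT, Real.mul_iSup_of_nonneg ht.le]
  rw [if_neg hT, if_neg hT]
  by_cases h0 : r = 0
  · rw [if_pos h0, if_pos h0, Finset.prod_mul_distrib, Finset.prod_const, Finset.card_univ,
      Fintype.card_fin, Real.mul_rpow (by positivity) (Finset.prod_nonneg fun i _ => (hv i).le),
      ← Real.rpow_natCast, ← Real.rpow_mul ht.le, mul_one_div_cancel hK', Real.rpow_one]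
  rw [if_neg h0, if_neg h0, if_neg (fun h => h2 h.2), if_neg (fun h => h1 h.2)]
  have hr : r.toReal ≠ 0 := by
    rw [Ne, EReal.toReal_eq_zero_iff]; tauto
  have hs : 0 ≤ (∑ i, v i ^ r.toReal) / K :=
    div_nonneg (Finset.sum_nonneg fun i _ => Real.rpow_nonneg (hv i).le _) (Nat.cast_nonneg _)
  simp_rw [Real.mul_rpow ht.le (hv _).le]
  rw [← Finset.mul_sum, mul_div_assoc, Real.mul_rpow (by positivity) hs, ← Real.rpow_mul ht.le,
    mul_one_div_cancel hr, Real.rpow_one]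

/-- If the Cauchy combining function were equivalent to `M_{r,K}` near the origin, then `M_{r,K}`
would be the harmonic mean. -/
lemma powerMean_eq_harmonicMean_of_tendsto {K : ℕ} (hK : 1 ≤ K) (r : EReal)
    (h : Tendsto (fun p : Fin K → ℝ => cauchyMean p / powerMean r p)
        (comap (fun p => ⨆ i, p i) (𝓝[>] 0) ⊓ 𝓟 {p | ∀ i, 0 < p i}) (𝓝 1))
    {v : Fin K → ℝ} (hv : ∀ i, 0 < v i) : powerMean r v = harmonicMean v := by
  have : Nonempty (Fin K) := ⟨⟨0, hK⟩⟩
  have hlin : ∀ a : ℝ, 0 < a → Tendsto (fun t : ℝ => t * a) (𝓝[>] 0) (𝓝[>] 0) := by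
    intro a ha
    refine tendsto_nhdsWithin_iff.2 ⟨?_, ?_⟩
    · exact (Continuous.tendsto' (by fun_prop) _ _ (by simp)).mono_left nhdsWithin_le_nhds
    · filter_upwards [self_mem_nhdsWithin] with t (ht : 0 < t) using mul_pos ht ha
  have hpos : ∀ᶠ t : ℝ in 𝓝[>] 0, ∀ i, 0 < t * v i := by
    filter_upwards [self_mem_nhdsWithin] with t (ht : 0 < t) i using mul_pos ht (hv i)
  -- The ray through `v` tends to the origin in the sense of both limits, so both can be evaluated
  -- along it; by homogeneity the ratio of the two means is constant there.
  have h1 : Tendsto (fun (t : ℝ) i => t * v i) (𝓝[>] 0)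
      (comap (fun p : Fin K → ℝ => ⨆ i, p i) (𝓝[>] 0) ⊓ 𝓟 {p | ∀ i, 0 < p i}) := by
    refine tendsto_inf.2 ⟨tendsto_comap_iff.2 ?_, tendsto_principal.2 hpos⟩
    refine (hlin (⨆ i, v i) ?_).congr' ?_
    · obtain ⟨i, hi⟩ := exists_eq_ciSup_of_finite (f := v)
      rw [← hi]; exact hv i
    · filter_upwards [self_mem_nhdsWithin] with t (ht : 0 < t)
      exact Real.mul_iSup_of_nonneg ht.le _
  have h2 : Tendsto (fun (t : ℝ) i => t * v i) (𝓝[>] 0)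
      (comap (fun p : Fin K → ℝ => ⨅ i, p i) (𝓝[>] 0) ⊓ 𝓟 {p | ∀ i, p i ≤ 1 / 2}) := by
    refine tendsto_inf.2 ⟨tendsto_comap_iff.2 ?_, tendsto_principal.2 ?_⟩
    · refine (hlin (⨅ i, v i) ?_).congr' ?_
      · obtain ⟨i, hi⟩ := exists_eq_ciInf_of_finite (f := v)
        rw [← hi]; exact hv i
      · filter_upwards [self_mem_nhdsWithin] with t (ht : 0 < t)
        exact Real.mul_iInf_of_nonneg ht.le _
    · refine eventually_all.2 fun i => ?_
      have := tendsto_nhds_of_tendsto_nhdsWithin (hlin (v i) (hv i))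
      exact (this.eventually (gt_mem_nhds (by norm_num : (0 : ℝ) < 1 / 2))).mono fun t ht => ht.le
  have h3 := h.comp h1
  have h4 := (tendsto_cauchyMean_div_harmonicMean hK (by norm_num : (1 / 2 : ℝ) < 1)).comp h2
  have h5 := h4.mul_const (harmonicMean v / powerMean r v)
  have h6 : harmonicMean v / powerMean r v = 1 := by
    rw [one_mul] at h5
    refine tendsto_nhds_unique (h5.congr' ?_) h3
    filter_upwards [self_mem_nhdsWithin, hpos] with t (ht : 0 < t) hp
    have e1 : harmonicMean (fun i => t * v i) = t * harmonicMean v := powerMean_mul hK _ ht hv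
    have e2 := powerMean_mul hK r ht hv
    have hH := harmonicMean_pos hK hv
    simp only [Function.comp]
    rw [e1, e2]
    field_simp
  have h7 : powerMean r v ≠ 0 := by rintro h0; simp [h0] at h6
  field_simp at h6
  exact h6.symm

/-- Strictness in Jensen's inequality for power functions, at the exponents `s ≠ 0, 1`. -/
lemma exists_rpow_mean_ne {n : ℕ} (hn : 1 ≤ n) {s : ℝ} (h0 : s ≠ 0) (h1 : s ≠ 1) :
    ∃ y : ℝ, 0 < y ∧ (y ^ s + n) / (n + 1) ≠ ((y + n) / (n + 1)) ^ s := by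
  have hn' : (1 : ℝ) ≤ n := by exact_mod_cast hn
  have ha : (0 : ℝ) < 1 / (n + 1) := by positivity
  have hb : (0 : ℝ) < n / (n + 1) := by positivity
  have hab : (1 : ℝ) / (n + 1) + n / (n + 1) = 1 := by field_simp; ring
  have e1 : ((2 : ℝ) + n) / (n + 1) = 1 / (n + 1) * 2 + n / (n + 1) * 1 := by ring
  have e2 : ((2 : ℝ) ^ s + n) / (n + 1) = 1 / (n + 1) * 2 ^ s + n / (n + 1) * 1 ^ s := by
    rw [Real.one_rpow]; ring
  rcases lt_trichotomy s 0 with hs | hs | hs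
  · have hg : (1 : ℝ) < (n + 1) ^ (-2 / s) := by
      apply Real.one_lt_rpow (by linarith)
      exact div_pos_of_neg_of_neg (by norm_num) hs
    -- This `y` makes the mean equal to `(n + 1) ^ (-2 / s)`, so the right side is `(n + 1) ^ (-2)`,
    -- while the left side exceeds `n / (n + 1)`.
    refine ⟨(n + 1) * (n + 1) ^ (-2 / s) - n, by nlinarith, ?_⟩
    have hy : 0 < (n + 1) * ((n : ℝ) + 1) ^ (-2 / s) - n := by nlinarith
    apply ne_of_gt
    rw [sub_add_cancel, mul_div_cancel_left₀ _ (by positivity), ← Real.rpow_mul (by positivity),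
      div_mul_cancel₀ _ h0, lt_div_iff₀ (by positivity)]
    have := Real.rpow_pos_of_pos hy s
    rw [Real.rpow_neg (by positivity), Real.rpow_two]
    have : (((n : ℝ) + 1) ^ 2)⁻¹ * ((n : ℝ) + 1) ≤ 1 := by
      rw [inv_mul_le_iff₀ (by positivity)]; nlinarith
    linarith
  · exact absurd hs h0
  rcases lt_or_gt_of_ne h1 with hs1 | hs1
  · refine ⟨2, by norm_num, ne_of_lt ?_⟩
    rw [e1, e2]
    exact (Real.strictConcaveOn_rpow hs hs1).2 (by simp) (by simp) (by norm_num) ha hb hab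
  · refine ⟨2, by norm_num, ne_of_gt ?_⟩
    rw [e1, e2]
    exact (strictConvexOn_rpow hs1).2 (by simp) (by simp) (by norm_num) ha hb hab

/-- Vectors `(x, 1, …, 1)` suffice. For finite `r ≠ 0`, setting `y = 1 / x` and `s = -r` turns
equality of the two means into equality in Jensen's inequality for the power `s`. -/
lemma exists_powerMean_ne_harmonicMean {K : ℕ} (hK : 2 ≤ K) {r : EReal} (hr : r ≠ -1) :
    ∃ v : Fin K → ℝ, (∀ i, 0 < v i) ∧ powerMean r v ≠ harmonicMean v := by
  obtain ⟨n, rfl⟩ : ∃ n, K = n + 1 := ⟨K - 1, by omega⟩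
  have hn : 1 ≤ n := by omega
  have hn' : (1 : ℝ) ≤ n := by exact_mod_cast hn
  have hv : ∀ x : ℝ, 0 < x → ∀ i, 0 < (Fin.cons x (fun _ => 1) : Fin (n + 1) → ℝ) i := by
    intro x hx i
    refine Fin.cases ?_ (fun j => ?_) i <;> simp [hx]
  have hH : ∀ x : ℝ, 0 < x → harmonicMean (Fin.cons x (fun _ => 1) : Fin (n + 1) → ℝ) =
      ((x⁻¹ + n) / (n + 1))⁻¹ := by
    intro x hx
    rw [harmonicMean_eq (hv x hx), Fin.sum_univ_succ]
    simp
  by_cases hb : r = ⊥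
  · refine ⟨_, hv (1 / 2) (by norm_num), ?_⟩
    rw [hH _ (by norm_num), powerMean, if_pos hb]
    apply ne_of_lt
    refine (ciInf_le (Set.finite_range _).bddBelow 0).trans_lt ?_
    rw [Fin.cons_zero, inv_div, lt_div_iff₀ (by positivity)]
    norm_num
    linarith
  by_cases hT : r = ⊤
  · refine ⟨_, hv (1 / 2) (by norm_num), ?_⟩
    rw [hH _ (by norm_num), powerMean, if_neg hb, if_pos hT]
    apply ne_of_gt
    refine lt_of_lt_of_le ?_ (le_ciSup (Set.finite_range _).bddAbove (Fin.succ ⟨0, hn⟩))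
    rw [Fin.cons_succ, inv_div, div_lt_iff₀ (by positivity)]
    norm_num
    linarith
  by_cases h0 : r = 0
  -- With this first coordinate the geometric mean is exactly `1 / 2`.
  · refine ⟨_, hv ((1 / 2) ^ (n + 1)) (by positivity), ?_⟩
    rw [hH _ (by positivity), powerMean, if_neg hb, if_neg hT, if_pos h0, Fin.prod_univ_succ]
    simp only [Fin.cons_zero, Fin.cons_succ, Finset.prod_const_one, mul_one]
    rw [← Real.rpow_natCast, ← Real.rpow_mul (by norm_num), mul_one_div_cancel (by positivity),
      Real.rpow_one, Real.rpow_natCast, ← inv_pow, one_div, inv_inv, inv_div]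
    have h2 : n + 2 < 2 ^ (n + 1) := by
      have := Nat.lt_two_pow_self (n := n)
      rw [pow_succ]; omega
    have h3 : (n : ℝ) + 2 < 2 ^ (n + 1) := by exact_mod_cast h2
    apply ne_of_gt
    rw [div_lt_iff₀ (by positivity)]
    linarith
  have hr0 : r.toReal ≠ 0 := by
    rw [Ne, EReal.toReal_eq_zero_iff]; tauto
  have hr1 : -r.toReal ≠ 1 := by
    intro h
    apply hr
    have : r.toReal = -1 := by linarith
    rw [← EReal.coe_toReal hT hb, this]
    simp
  obtain ⟨y, hy, hne⟩ := exists_rpow_mean_ne hn (neg_ne_zero.2 hr0) hr1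
  refine ⟨_, hv y⁻¹ (by positivity), fun h => hne ?_⟩
  have h2 : ¬ ∃ i, (Fin.cons y⁻¹ (fun _ => 1) : Fin (n + 1) → ℝ) i = 0 := by
    rintro ⟨i, hi⟩; exact (hv y⁻¹ (by positivity) i).ne' hi
  rw [hH _ (by positivity), powerMean, if_neg hb, if_neg hT, if_neg h0,
    if_neg (fun h => h2 h.2), Fin.sum_univ_succ] at h
  simp only [Fin.cons_zero, Fin.cons_succ, Real.one_rpow, Finset.sum_const, Finset.card_univ,
    Fintype.card_fin, inv_inv, nsmul_eq_mul, mul_one, Nat.cast_add, Nat.cast_one] at h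
  rw [Real.inv_rpow hy.le, ← Real.rpow_neg hy.le] at h
  have h3 := congrArg (· ^ r.toReal) h
  beta_reduce at h3
  rwa [← Real.rpow_mul (by positivity), one_div_mul_cancel hr0, Real.rpow_one,
    Real.inv_rpow (by positivity), ← Real.rpow_neg (by positivity)] at h3

/-! ### One large summand: tails of sums with index `-1` -/

/-- A weighted sum exceeds `x` only if one term nearly does, or two variables are large. -/
lemma exists_large_of_lt_sum {ι : Type*} (R : Finset ι) {m z : ι → ℝ} {M δ x : ℝ}
    (hm : ∀ g ∈ R, 0 < m g) (hM : ∀ g ∈ R, m g ≤ M) (hδ0 : 0 < δ) (hδ1 : δ < 1) (hx : 0 < x)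
    (h : x < ∑ g ∈ R, m g * z g) :
    (∃ g ∈ R, (1 - δ) / m g * x < z g) ∨
      ∃ g ∈ R, ∃ k ∈ R, g ≠ k ∧ δ / (R.card * M) * x < z g ∧ δ / (R.card * M) * x < |z k| := by
  classical
  by_cases h1 : ∃ g ∈ R, (1 - δ) / m g * x < z g
  · exact Or.inl h1
  right
  push Not at h1
  have hR : R.Nonempty := by
    by_contra hR
    rw [Finset.not_nonempty_iff_eq_empty] at hR
    subst hR
    simp at h
    linarith
  have hc : (0 : ℝ) < R.card := by exact_mod_cast hR.card_pos
  have hM0 : 0 < M := by obtain ⟨g, hg⟩ := hR; exact (hm g hg).trans_le (hM g hg)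
  have key : ∀ g ∈ R, δ / R.card * x < m g * z g → δ / (R.card * M) * x < z g := by
    intro g hg hl
    have hz : 0 < z g := by
      have : 0 < m g * z g := lt_of_le_of_lt (by positivity) hl
      exact (pos_iff_pos_of_mul_pos this).1 (hm g hg)
    have h2 : m g * z g ≤ M * z g := by gcongr; exact hM g hg
    have e : δ / (R.card * M) * x = (δ / R.card * x) / M := by field_simp
    rw [e, div_lt_iff₀ hM0]
    linarith
  have hs : ∑ g ∈ R, δ / R.card * x = δ * x := by
    rw [Finset.sum_const, nsmul_eq_mul]; field_simp
  obtain ⟨g, hg, hgl⟩ : ∃ g ∈ R, δ / R.card * x < m g * z g := by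
    apply Finset.exists_lt_of_sum_lt
    rw [hs]
    nlinarith
  have hle : m g * z g ≤ (1 - δ) * x := by
    have h2 := h1 g hg
    have h3 := hm g hg
    calc m g * z g ≤ m g * ((1 - δ) / m g * x) := by gcongr
      _ = (1 - δ) * x := by field_simp
  -- The term at `g` uses at most `(1 - δ) x`, so the remaining terms still total more than `δ x`,
  -- and a second one must exceed its share.
  obtain ⟨k, hk, hkl⟩ : ∃ k ∈ R.erase g, δ / R.card * x < m k * z k := by
    apply Finset.exists_lt_of_sum_lt
    have h4 := Finset.add_sum_erase R (fun g => m g * z g) hg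
    have h5 := Finset.add_sum_erase R (fun _ => δ / R.card * x) hg
    have h6 : 0 < δ / R.card * x := by positivity
    rw [hs] at h5
    nlinarith
  have hk' := Finset.mem_erase.1 hk
  exact ⟨g, hg, k, hk'.2, hk'.1.symm, key g hg hgl, (key k hk'.2 hkl).trans_le (le_abs_self _)⟩

/-- If one term of a weighted sum is clearly larger than `x`, then so is the sum, unless another
variable is large in absolute value. -/
lemma lt_sum_of_large {ι : Type*} (R : Finset ι) {m z : ι → ℝ} {M δ x : ℝ}
    (hm : ∀ g ∈ R, 0 < m g) (hM : ∀ g ∈ R, m g ≤ M) (hδ0 : 0 < δ) (hx : 0 < x) {g : ι}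
    (hg : g ∈ R) (h : (1 + δ) / m g * x < z g)
    (hk : ∀ k ∈ R, g ≠ k → |z k| ≤ δ / (R.card * M) * x) :
    x < ∑ g ∈ R, m g * z g := by
  classical
  have hc : (0 : ℝ) < R.card := by exact_mod_cast Finset.card_pos.2 ⟨g, hg⟩
  have hM0 : 0 < M := (hm g hg).trans_le (hM g hg)
  rw [← Finset.add_sum_erase R _ hg]
  have h1 : (1 + δ) * x < m g * z g := by
    have h3 := hm g hg
    calc (1 + δ) * x = m g * ((1 + δ) / m g * x) := by field_simp
      _ < m g * z g := by gcongr
  have h2 : ∑ k ∈ R.erase g, -(δ / R.card * x) ≤ ∑ k ∈ R.erase g, m k * z k := by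
    refine Finset.sum_le_sum fun k hk' => ?_
    obtain ⟨hne, hkR⟩ := Finset.mem_erase.1 hk'
    have h4 := (abs_le.1 (hk k hkR hne.symm)).1
    have h5 := hm k hkR
    have h6 : 0 < δ / (R.card * M) * x := by positivity
    have h7 : m k * (δ / (R.card * M) * x) ≤ M * (δ / (R.card * M) * x) := by
      gcongr; exact hM k hkR
    have h8 : M * (δ / (R.card * M) * x) = δ / R.card * x := by field_simp
    nlinarith
  have h5 := Finset.add_sum_erase R (fun _ => -(δ / R.card * x)) hg
  have hs : ∑ g ∈ R, -(δ / R.card * x) = -(δ * x) := by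
    rw [Finset.sum_const, nsmul_eq_mul]; field_simp
  rw [hs] at h5
  have h6 : 0 < δ / R.card * x := by positivity
  linarith

/-- One large value dominates a weighted sum of asymptotically independent variables whose right
tails are regularly varying of index `-1`. -/
theorem tendsto_mul_tail_sum {Ω ι : Type*} [MeasurableSpace Ω] (P : Measure Ω)
    [IsProbabilityMeasure P] (R : Finset ι) {m : ι → ℝ} (hm : ∀ g ∈ R, 0 < m g) {Z : ι → Ω → ℝ}
    (hZ : ∀ g ∈ R, Measurable (Z g)) {c : ℝ}
    (htail : ∀ g ∈ R, Tendsto (fun x : ℝ => x * P.real {ω | x < Z g ω}) atTop (𝓝 c))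
    (hind : ∀ g ∈ R, ∀ k ∈ R, g ≠ k → ∀ δ : ℝ, 0 < δ →
      Tendsto (fun x : ℝ => x * P.real {ω | δ * x < Z g ω ∧ δ * x < |Z k ω|}) atTop (𝓝 0)) :
    Tendsto (fun x : ℝ => x * P.real {ω | x < ∑ g ∈ R, m g * Z g ω}) atTop
      (𝓝 (c * ∑ g ∈ R, m g)) := by
  classical
  rcases R.eq_empty_or_nonempty with rfl | hR
  · refine (tendsto_const_nhds (x := (0 : ℝ))).congr' ?_ |>.trans (by simp)
    filter_upwards [eventually_ge_atTop 0] with x hx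
    simp [hx.not_gt]
  obtain ⟨M, hM⟩ : ∃ M, ∀ g ∈ R, m g ≤ M := by
    obtain ⟨M, hM⟩ := (R.finite_toSet.image m).bddAbove
    exact ⟨M, fun g hg => hM ⟨g, hg, rfl⟩⟩
  have hM0 : 0 < M := by obtain ⟨g, hg⟩ := hR; exact (hm g hg).trans_le (hM g hg)
  have hc : (0 : ℝ) < R.card := by exact_mod_cast hR.card_pos
  -- The exceptional event: two different variables are large at scale `x`, the second possibly
  -- negative. It has probability `o(1 / x)`.
  set B : ℝ → ℝ → Set Ω := fun δ x => ⋃ g ∈ R, ⋃ k ∈ R.erase g,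
    {ω | δ / (R.card * M) * x < Z g ω ∧ δ / (R.card * M) * x < |Z k ω|} with hB
  have hBm : ∀ δ x, MeasurableSet (B δ x) := fun δ x =>
    Finset.measurableSet_biUnion _ fun g hg => Finset.measurableSet_biUnion _ fun k hk =>
      (measurableSet_lt measurable_const (hZ g hg)).inter
        (measurableSet_lt measurable_const
          (continuous_abs.measurable.comp (hZ k (Finset.mem_of_mem_erase hk))))
  have hBlim : ∀ δ, 0 < δ → Tendsto (fun x => x * P.real (B δ x)) atTop (𝓝 0) := by
    intro δ hδ
    have h0 : Tendsto (fun x : ℝ => ∑ g ∈ R, ∑ k ∈ R.erase g,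
        x * P.real {ω | δ / (R.card * M) * x < Z g ω ∧ δ / (R.card * M) * x < |Z k ω|}) atTop
        (𝓝 (∑ g ∈ R, ∑ k ∈ R.erase g, 0)) :=
      tendsto_finsetSum _ fun g hg => tendsto_finsetSum _ fun k hk =>
        hind g hg k (Finset.mem_of_mem_erase hk) (Finset.ne_of_mem_erase hk).symm _ (by positivity)
    simp only [Finset.sum_const_zero] at h0
    refine tendsto_of_tendsto_of_tendsto_of_le_of_le' tendsto_const_nhds h0 ?_ ?_
    · filter_upwards [eventually_ge_atTop 0] with x hx using mul_nonneg hx measureReal_nonneg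
    · filter_upwards [eventually_ge_atTop 0] with x hx
      simp_rw [← Finset.mul_sum]
      gcongr
      refine (measureReal_biUnion_finset_le _ _).trans (Finset.sum_le_sum fun g _ => ?_)
      exact measureReal_biUnion_finset_le _ _
  have hA : ∀ a, 0 < a → Tendsto (fun x => ∑ g ∈ R, x * P.real {ω | a / m g * x < Z g ω}) atTop
      (𝓝 (c * (∑ g ∈ R, m g) / a)) := by
    intro a ha
    have : c * (∑ g ∈ R, m g) / a = ∑ g ∈ R, m g / a * c := by
      rw [Finset.mul_sum, Finset.sum_div]
      exact Finset.sum_congr rfl fun g _ => by ring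
    rw [this]
    refine tendsto_finsetSum _ fun g hg => ?_
    have hmg := hm g hg
    have h1 := ((htail g hg).comp
      (tendsto_id.const_mul_atTop (by positivity : 0 < a / m g))).const_mul (m g / a)
    refine h1.congr fun x => ?_
    simp only [Function.comp, id]
    field_simp
  have hup : ∀ δ, 0 < δ → δ < 1 → ∀ᶠ x in atTop, x * P.real {ω | x < ∑ g ∈ R, m g * Z g ω} ≤
      (∑ g ∈ R, x * P.real {ω | (1 - δ) / m g * x < Z g ω}) + x * P.real (B δ x) := by
    intro δ h0 h1
    filter_upwards [eventually_gt_atTop 0] with x hx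
    have hsub : {ω | x < ∑ g ∈ R, m g * Z g ω} ⊆
        (⋃ g ∈ R, {ω | (1 - δ) / m g * x < Z g ω}) ∪ B δ x := by
      intro ω hω
      rcases exists_large_of_lt_sum R hm hM h0 h1 hx hω with ⟨g, hg, h⟩ | ⟨g, hg, k, hk, hne, h⟩
      · exact Or.inl (Set.mem_biUnion (x := g) hg h)
      · exact Or.inr (Set.mem_biUnion (x := g) hg
          (Set.mem_biUnion (x := k) (Finset.mem_coe.2 (Finset.mem_erase.2 ⟨hne.symm, hk⟩)) h))
    rw [← Finset.mul_sum, ← mul_add]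
    gcongr
    refine (measureReal_mono hsub).trans ((measureReal_union_le _ _).trans ?_)
    gcongr
    exact measureReal_biUnion_finset_le _ _
  have hlow : ∀ δ, 0 < δ → ∀ᶠ x in atTop,
      (∑ g ∈ R, x * P.real {ω | (1 + δ) / m g * x < Z g ω}) - R.card * (x * P.real (B δ x)) ≤
      x * P.real {ω | x < ∑ g ∈ R, m g * Z g ω} := by
    intro δ h0
    filter_upwards [eventually_gt_atTop 0] with x hx
    -- The level used in `B` lies below the level for a single large term; hence, off `B`, the
    -- events of a single large term are disjoint and their probabilities add.
    have hbig : ∀ g ∈ R, δ / (R.card * M) ≤ (1 + δ) / m g := by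
      intro g hg
      have := hm g hg
      have h1 : (1 : ℝ) ≤ R.card := by exact_mod_cast hR.card_pos
      apply div_le_div₀ <;> nlinarith [hM g hg]
    have hdisj : Set.PairwiseDisjoint (R : Set ι)
        (fun g => {ω | (1 + δ) / m g * x < Z g ω} \ B δ x) := by
      intro g hg k hk hne
      refine Set.disjoint_left.2 fun ω hω hω' => hω.2 ?_
      refine Set.mem_biUnion hg (Set.mem_biUnion
        (Finset.mem_coe.2 (Finset.mem_erase.2 ⟨hne.symm, hk⟩)) ⟨?_, ?_⟩)
      · exact lt_of_le_of_lt (mul_le_mul_of_nonneg_right (hbig g hg) hx.le) hω.1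
      · exact (lt_of_le_of_lt (mul_le_mul_of_nonneg_right (hbig k hk) hx.le) hω'.1).trans_le
          (le_abs_self _)
    have hAm : ∀ g ∈ R, MeasurableSet {ω | (1 + δ) / m g * x < Z g ω} := fun g hg =>
      measurableSet_lt measurable_const (hZ g hg)
    have hsub : (⋃ g ∈ R, {ω | (1 + δ) / m g * x < Z g ω} \ B δ x) ⊆
        {ω | x < ∑ g ∈ R, m g * Z g ω} := by
      intro ω hω
      simp only [Set.mem_iUnion] at hω
      obtain ⟨g, hg, hω1, hω2⟩ := hω
      refine lt_sum_of_large R hm hM h0 hx hg hω1 fun k hk hne => ?_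
      by_contra! hlt
      refine hω2 (Set.mem_biUnion (x := g) hg (Set.mem_biUnion (x := k)
        (Finset.mem_coe.2 (Finset.mem_erase.2 ⟨hne.symm, hk⟩)) ⟨?_, hlt⟩))
      exact lt_of_le_of_lt (mul_le_mul_of_nonneg_right (hbig g hg) hx.le) hω1
    have hmeas := measureReal_mono hsub (μ := P)
    rw [measureReal_biUnion_finset hdisj (fun g hg => (hAm g hg).diff (hBm δ x))] at hmeas
    have hge : ∑ g ∈ R, (P.real {ω | (1 + δ) / m g * x < Z g ω} - P.real (B δ x)) ≤
        ∑ g ∈ R, P.real ({ω | (1 + δ) / m g * x < Z g ω} \ B δ x) :=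
      Finset.sum_le_sum fun g _ => le_measureReal_sdiff (measure_ne_top P _)
    rw [Finset.sum_sub_distrib, Finset.sum_const, nsmul_eq_mul] at hge
    rw [← Finset.mul_sum]
    nlinarith [hge.trans hmeas]
  have hcont : ∀ s : ℝ, Tendsto (fun δ : ℝ => c * (∑ g ∈ R, m g) / (1 + s * δ)) (𝓝[>] 0)
      (𝓝 (c * ∑ g ∈ R, m g)) := by
    intro s
    have : ContinuousAt (fun δ : ℝ => c * (∑ g ∈ R, m g) / (1 + s * δ)) 0 :=
      ContinuousAt.div (by fun_prop) (by fun_prop) (by simp)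
    have h := this.tendsto.mono_left (nhdsWithin_le_nhds (s := Set.Ioi 0))
    simpa using h
  have hsmall : ∀ᶠ δ : ℝ in 𝓝[>] 0, 0 < δ ∧ δ < 1 := Ioo_mem_nhdsGT one_pos
  -- A `δ` is fixed close enough to `0` first, and then `x → ∞` in the two-sided bounds.
  rw [tendsto_order]
  constructor
  · intro a ha
    obtain ⟨δ, hδ, h0, -⟩ := (((hcont 1).eventually (lt_mem_nhds ha)).and hsmall).exists
    rw [one_mul] at hδ
    have h1 := (hA (1 + δ) (by linarith)).sub ((hBlim δ h0).const_mul (R.card : ℝ))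
    rw [mul_zero, sub_zero] at h1
    filter_upwards [h1.eventually (lt_mem_nhds hδ), hlow δ h0] with x h2 h3
    exact h2.trans_le h3
  · intro a ha
    obtain ⟨δ, hδ, h0, hδ1⟩ := (((hcont (-1)).eventually (gt_mem_nhds ha)).and hsmall).exists
    rw [neg_one_mul, ← sub_eq_add_neg] at hδ
    have h1 := (hA (1 - δ) (by linarith)).add (hBlim δ h0)
    rw [add_zero] at h1
    filter_upwards [h1.eventually (gt_mem_nhds hδ), hup δ h0 hδ1] with x h2 h3
    exact h3.trans_lt h2

/-- The tail of a finite sum of variables that are pairwise almost surely equal or asymptotically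
independent. -/
theorem tendsto_mul_tail_sum_of_ae_eq_or {Ω ι : Type*} [Fintype ι] [MeasurableSpace Ω]
    (P : Measure Ω) [IsProbabilityMeasure P] {Z : ι → Ω → ℝ} (hZ : ∀ i, Measurable (Z i)) {c : ℝ}
    (htail : ∀ i, Tendsto (fun x : ℝ => x * P.real {ω | x < Z i ω}) atTop (𝓝 c))
    (hind : ∀ i j, Z i =ᵐ[P] Z j ∨ ∀ δ : ℝ, 0 < δ →
      Tendsto (fun x : ℝ => x * P.real {ω | δ * x < Z i ω ∧ δ * x < |Z j ω|}) atTop (𝓝 0)) :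
    Tendsto (fun x : ℝ => x * P.real {ω | x < ∑ i, Z i ω}) atTop (𝓝 (c * Fintype.card ι)) := by
  classical
  -- Almost surely equal variables form classes. One representative per class, weighted by the class
  -- size, has the same sum, and distinct representatives are asymptotically independent.
  let s : Setoid ι :=
    { r := fun i j => Z i =ᵐ[P] Z j
      iseqv := ⟨fun _ => ae_eq_rfl, fun h => h.symm, fun h h' => h.trans h'⟩ }
  let m : Quotient s → ℝ := fun q => ((Finset.univ.filter fun i : ι => (⟦i⟧ : Quotient s) = q).card : ℝ)
  have hm : ∀ q, 0 < m q := by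
    intro q
    refine Nat.cast_pos.2 (Finset.card_pos.2 ⟨q.out, ?_⟩)
    simp
  have hsum : ∑ q, m q = Fintype.card ι := by
    have := Finset.card_eq_sum_card_fiberwise (s := (Finset.univ : Finset ι))
      (t := (Finset.univ : Finset (Quotient s))) (f := fun i => (⟦i⟧ : Quotient s)) (by simp)
    rw [← Finset.card_univ, this]
    push_cast
    rfl
  have h1 := tendsto_mul_tail_sum P (Finset.univ : Finset (Quotient s)) (m := m)
    (fun q _ => hm q) (Z := fun q => Z q.out) (fun q _ => hZ _) (fun q _ => htail _)
    (fun q _ q' _ hne => by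
      refine (hind q.out q'.out).resolve_left fun h => hne ?_
      rw [← Quotient.out_eq q, ← Quotient.out_eq q']
      exact Quotient.sound h)
  rw [hsum] at h1
  refine h1.congr fun x => ?_
  congr 1
  apply measureReal_congr
  have hae : ∀ᵐ ω ∂P, ∀ i : ι, Z i ω = Z (⟦i⟧ : Quotient s).out ω := by
    refine ae_all_iff.2 fun i => ?_
    have : Z (⟦i⟧ : Quotient s).out =ᵐ[P] Z i := Quotient.mk_out (s := s) i
    exact this.symm
  filter_upwards [hae] with ω hω
  have : ∑ q, m q * Z q.out ω = ∑ i, Z i ω := by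
    rw [← Finset.sum_fiberwise (s := Finset.univ) (g := fun i => (⟦i⟧ : Quotient s))]
    refine Finset.sum_congr rfl fun q _ => ?_
    rw [Finset.sum_congr rfl (g := fun _ => Z q.out ω), Finset.sum_const, nsmul_eq_mul]
    intro i hi
    rw [hω i, (Finset.mem_filter.1 hi).2]
  exact congrArg (x < ·) this |>.to_iff |> propext

/-! ### Gaussian tails and Gaussian copulas -/

/-- Dominated convergence for the indicators of `Iic t`: they converge except at the limiting
endpoint, which is a null set. -/
lemma continuous_measureReal_Iic (ν : Measure ℝ) [IsFiniteMeasure ν] [NullSingletonClass ν] :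
    Continuous fun t => ν.real (Set.Iic t) := by
  have h : ∀ t, ν.real (Set.Iic t) = ∫ x, (Set.Iic t).indicator 1 x ∂ν := fun t =>
    (integral_indicator_one measurableSet_Iic).symm
  simp_rw [h]
  refine continuous_iff_continuousAt.2 fun t₀ => ?_
  refine continuousAt_of_dominated (bound := fun _ => 1) (.of_forall fun t => ?_)
    (.of_forall fun t => .of_forall fun x => ?_) (integrable_const _) ?_
  · exact (measurable_one.indicator measurableSet_Iic).aestronglyMeasurable
  · by_cases hx : x ∈ Set.Iic t <;> simp [hx]
  · have : ∀ᵐ x ∂ν, x ≠ t₀ := by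
      simp [ae_iff]
    filter_upwards [this] with x hx
    rcases lt_or_gt_of_ne hx with hx | hx
    · refine (continuousAt_const (y := (1 : ℝ))).congr ?_
      filter_upwards [lt_mem_nhds hx] with t ht
      simp [ht.le]
    · refine (continuousAt_const (y := (0 : ℝ))).congr ?_
      filter_upwards [gt_mem_nhds hx] with t ht
      simp [ht]

lemma stdNormalCDF_eq (x : ℝ) : stdNormalCDF x = (gaussianReal 0 1).real (Set.Iic x) :=
  cdf_eq_real _ _

lemma stdNormalCDF_mono : Monotone stdNormalCDF := monotone_cdf _

lemma continuous_stdNormalCDF : Continuous stdNormalCDF := by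
  have := nullSingletonClass_gaussianReal (μ := 0) (v := 1) one_ne_zero
  simpa only [← stdNormalCDF_eq] using continuous_measureReal_Iic (gaussianReal 0 1)

lemma stdNormalCDF_neg (x : ℝ) : stdNormalCDF (-x) = 1 - stdNormalCDF x := by
  have := nullSingletonClass_gaussianReal (μ := 0) (v := 1) one_ne_zero
  have h1 : (gaussianReal 0 1).real (Set.Iic (-x)) = (gaussianReal 0 1).real (Set.Ici x) := by
    have h := gaussianReal_map_neg (μ := 0) (v := 1)
    rw [neg_zero] at h
    conv_lhs => rw [← h]
    rw [map_measureReal_apply measurable_neg measurableSet_Iic]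
    congr 1
    ext y
    simp
  have h2 : (gaussianReal 0 1).real (Set.Ici x) = (gaussianReal 0 1).real (Set.Iic x)ᶜ := by
    rw [Set.compl_Iic]
    exact measureReal_congr Ioi_ae_eq_Ici.symm
  rw [stdNormalCDF_eq, stdNormalCDF_eq, h1, h2, probReal_compl_eq_one_sub measurableSet_Iic]

/-- A lower bound for the left tail of the standard normal distribution. -/
lemma le_stdNormalCDF_neg {t : ℝ} (ht : 0 ≤ t) :
    (√(2 * Real.pi))⁻¹ * Real.exp (-(t + 1) ^ 2 / 2) ≤ stdNormalCDF (-t) := by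
  rw [stdNormalCDF_eq]
  -- An interval of length `1` is enough; the density on it is at least its value at `-t - 1`.
  have h1 : (gaussianReal 0 1).real (Set.Icc (-t - 1) (-t)) ≤ (gaussianReal 0 1).real (Set.Iic (-t)) :=
    measureReal_mono Set.Icc_subset_Iic_self
  refine le_trans ?_ h1
  rw [measureReal_def, ← ENNReal.ofReal_le_iff_le_toReal (measure_ne_top _ _),
    gaussianReal_apply _ one_ne_zero]
  have h2 : ∫⁻ _ in Set.Icc (-t - 1) (-t),
      ENNReal.ofReal ((√(2 * Real.pi))⁻¹ * Real.exp (-(t + 1) ^ 2 / 2)) =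
      ENNReal.ofReal ((√(2 * Real.pi))⁻¹ * Real.exp (-(t + 1) ^ 2 / 2)) := by
    rw [setLIntegral_const, Real.volume_Icc]
    simp
  rw [← h2]
  refine setLIntegral_mono' measurableSet_Icc fun x hx => ENNReal.ofReal_le_ofReal ?_
  simp only [gaussianPDFReal, NNReal.coe_one, mul_one, sub_zero]
  have h3 : x ^ 2 ≤ (t + 1) ^ 2 := sq_le_sq' (by linarith [hx.1]) (by linarith [hx.2])
  exact mul_le_mul_of_nonneg_left (Real.exp_le_exp.2 (by linarith)) (by positivity)

/-- Gaussian tails with variance below `4`, taken at twice the level, are negligible with respect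
to the standard normal tail. -/
lemma eventually_exp_le_mul_stdNormalCDF {w : ℝ} (hw0 : 0 < w) (hw : w < 4) {η : ℝ} (hη : 0 < η) :
    ∀ᶠ t in atTop, Real.exp (-(2 * t ^ 2 / w)) ≤ η * stdNormalCDF (-t) := by
  have hs : 0 < √(2 * Real.pi) := Real.sqrt_pos.2 (by positivity)
  have ha : (1 : ℝ) / 2 - 2 / w < 0 := by
    have : 1 / 2 < 2 / w := by rw [div_lt_div_iff₀ two_pos hw0]; linarith
    linarith
  -- This is the exponent of the quotient of `exp (-(2 t ^ 2 / w))` by `exp (-(t + 1) ^ 2 / 2)`; its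
  -- leading coefficient is negative exactly because `w < 4`.
  have h1 : Tendsto (fun t : ℝ => t * ((1 / 2 - 2 / w) * t + 1) + 1 / 2) atTop atBot := by
    refine tendsto_atBot_add_const_right _ _ (tendsto_id.atTop_mul_atBot₀ ?_)
    exact tendsto_atBot_add_const_right _ _ (tendsto_id.const_mul_atTop_of_neg ha)
  have h2 := (Real.tendsto_exp_atBot.comp h1).eventually
    (gt_mem_nhds (show 0 < η * (√(2 * Real.pi))⁻¹ by positivity))
  filter_upwards [h2, eventually_ge_atTop 0] with t h3 h0
  calc Real.exp (-(2 * t ^ 2 / w))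
      = Real.exp (t * ((1 / 2 - 2 / w) * t + 1) + 1 / 2) * Real.exp (-(t + 1) ^ 2 / 2) := by
        rw [← Real.exp_add]; congr 1; ring
    _ ≤ η * (√(2 * Real.pi))⁻¹ * Real.exp (-(t + 1) ^ 2 / 2) := by
        gcongr
        exact h3.le
    _ = η * ((√(2 * Real.pi))⁻¹ * Real.exp (-(t + 1) ^ 2 / 2)) := by ring
    _ ≤ _ := by gcongr; exact le_stdNormalCDF_neg h0

/-- Chernoff's bound with the parameter optimal for variance `w`. Working with an upper bound `w >
0` for the variance `v` allows `v = 0`. -/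
lemma gaussianReal_real_Iic_le {v : NNReal} {w : ℝ} (hw0 : 0 < w) (hv : v ≤ w) {t : ℝ}
    (ht : 0 ≤ t) :
    (gaussianReal 0 v).real (Set.Iic (-(2 * t))) ≤ Real.exp (-(2 * t ^ 2 / w)) := by
  have h := measure_le_le_exp_mul_mgf (μ := gaussianReal 0 v) (X := id) (t := -(2 * t / w))
    (-(2 * t)) (by have : 0 ≤ 2 * t / w := by positivity
                   linarith) (integrable_exp_mul_gaussianReal _)
  refine h.trans ?_
  rw [mgf_id_gaussianReal, ← Real.exp_add, Real.exp_le_exp]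
  have h1 : (v : ℝ) * (2 * t ^ 2 / w ^ 2) ≤ w * (2 * t ^ 2 / w ^ 2) := by gcongr
  have h2 : w * (2 * t ^ 2 / w ^ 2) = 2 * t ^ 2 / w := by field_simp
  have h3 : - -(2 * t / w) * -(2 * t) + (0 * -(2 * t / w) + v * (-(2 * t / w)) ^ 2 / 2) =
    v * (2 * t ^ 2 / w ^ 2) - 2 * (2 * t ^ 2 / w) := by field_simp; ring
  rw [h3]
  linarith

/-- Every small level is a value of the standard normal distribution function far to the left. -/
lemma exists_stdNormalCDF_neg_eq {u T : ℝ} (hu : 0 < u) (hT : u < stdNormalCDF (-T)) :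
    ∃ t, T < t ∧ stdNormalCDF (-t) = u := by
  have h0 : ∀ᶠ s in atBot, stdNormalCDF s < u := (tendsto_cdf_atBot _).eventually (gt_mem_nhds hu)
  obtain ⟨s, hs⟩ := h0.exists
  obtain ⟨r, hr⟩ := mem_range_of_exists_le_of_exists_ge continuous_stdNormalCDF ⟨s, hs.le⟩
    ⟨-T, hT.le⟩
  refine ⟨-r, ?_, by simpa using hr⟩
  by_contra! hle
  exact absurd (stdNormalCDF_mono (show -T ≤ r by linarith)) (by rw [hr]; exact not_le.2 hT)

/-- Joint events which force a Gaussian variable of variance below `4` to be below twice the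
normal quantile of level `u` have probability `o(u)`. -/
lemma isLittleO_of_gaussian_tail {α : Type*} [MeasurableSpace α] (ν : Measure α)
    [IsProbabilityMeasure ν] {L : α → ℝ} (hL : Measurable L) {v : NNReal}
    (hmap : ν.map L = gaussianReal 0 v) (hv : (v : ℝ) < 4) {S : ℝ → Set α}
    (hS : ∀ t, S (stdNormalCDF (-t)) ⊆ {x | L x ≤ -(2 * t)}) :
    (fun u => ν.real (S u)) =o[𝓝[>] 0] fun u => u := by
  refine isLittleO_iff.2 fun η hη => ?_
  have hw0 : 0 < max (v : ℝ) 1 := by positivity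
  have hw4 : max (v : ℝ) 1 < 4 := max_lt hv (by norm_num)
  obtain ⟨T, hT⟩ := eventually_atTop.1 (eventually_exp_le_mul_stdNormalCDF hw0 hw4 hη)
  have hpos : 0 < stdNormalCDF (-max T 0) :=
    lt_of_lt_of_le (by positivity) (le_stdNormalCDF_neg (le_max_right T 0))
  filter_upwards [Ioo_mem_nhdsGT hpos] with u hu
  obtain ⟨t, ht, rfl⟩ := exists_stdNormalCDF_neg_eq hu.1 hu.2
  have ht0 : 0 ≤ t := (le_max_right T 0).trans ht.le
  rw [Real.norm_of_nonneg measureReal_nonneg, Real.norm_of_nonneg hu.1.le]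
  calc ν.real (S (stdNormalCDF (-t))) ≤ ν.real {x | L x ≤ -(2 * t)} := measureReal_mono (hS t)
    _ = (gaussianReal 0 v).real (Set.Iic (-(2 * t))) := by
        rw [← hmap, map_measureReal_apply hL measurableSet_Iic]; rfl
    _ ≤ Real.exp (-(2 * t ^ 2 / max (v : ℝ) 1)) :=
        gaussianReal_real_Iic_le hw0 (le_max_left _ _) ht0
    _ ≤ _ := hT t ((le_max_left T 0).trans ht.le)

section Bivariate

variable {ν : Measure (ℝ × ℝ)} [IsGaussian ν] {ρ : ℝ}

/-- A linear functional of a Gaussian measure is Gaussian, so mean and variance determine its law.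
-/
lemma map_fst_add_snd (h1 : ν.map Prod.fst = gaussianReal 0 1)
    (h2 : ν.map Prod.snd = gaussianReal 0 1) (hρ : covariance Prod.fst Prod.snd ν = ρ) :
    ν.map (fun p => p.1 + p.2) = gaussianReal 0 (2 + 2 * ρ).toNNReal := by
  have hL1 : MemLp (Prod.fst : ℝ × ℝ → ℝ) 2 ν :=
    IsGaussian.memLp_dual ν (ContinuousLinearMap.fst ℝ ℝ ℝ) 2 (by simp)
  have hL2 : MemLp (Prod.snd : ℝ × ℝ → ℝ) 2 ν :=
    IsGaussian.memLp_dual ν (ContinuousLinearMap.snd ℝ ℝ ℝ) 2 (by simp)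
  have hi1 : ∫ p, p.1 ∂ν = 0 := by
    have := integral_map (μ := ν) (φ := Prod.fst) (f := fun x : ℝ => x) (by fun_prop) (by fun_prop)
    rw [← this, h1, integral_id_gaussianReal]
  have hi2 : ∫ p, p.2 ∂ν = 0 := by
    have := integral_map (μ := ν) (φ := Prod.snd) (f := fun x : ℝ => x) (by fun_prop) (by fun_prop)
    rw [← this, h2, integral_id_gaussianReal]
  have hv1 : Var[Prod.fst; ν] = 1 := by
    have := variance_map (μ := ν) (Y := Prod.fst) (X := (id : ℝ → ℝ)) (by fun_prop) (by fun_prop)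
    rw [h1, variance_id_gaussianReal] at this
    simpa using this.symm
  have hv2 : Var[Prod.snd; ν] = 1 := by
    have := variance_map (μ := ν) (Y := Prod.snd) (X := (id : ℝ → ℝ)) (by fun_prop) (by fun_prop)
    rw [h2, variance_id_gaussianReal] at this
    simpa using this.symm
  have h := IsGaussian.map_eq_gaussianReal (μ := ν)
    (ContinuousLinearMap.fst ℝ ℝ ℝ + ContinuousLinearMap.snd ℝ ℝ ℝ)
  have hf : ⇑(ContinuousLinearMap.fst ℝ ℝ ℝ + ContinuousLinearMap.snd ℝ ℝ ℝ) =
    fun p : ℝ × ℝ => p.1 + p.2 := rfl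
  rw [hf, variance_fun_add hL1 hL2, hv1, hv2, hρ,
    integral_add (hL1.integrable (by norm_num)) (hL2.integrable (by norm_num)), hi1, hi2] at h
  rw [h]
  congr 2
  · ring
  · ring

lemma map_fst_sub_snd (h1 : ν.map Prod.fst = gaussianReal 0 1)
    (h2 : ν.map Prod.snd = gaussianReal 0 1) (hρ : covariance Prod.fst Prod.snd ν = ρ) :
    ν.map (fun p => p.1 - p.2) = gaussianReal 0 (2 - 2 * ρ).toNNReal := by
  -- Reflecting the second coordinate changes the sign of `ρ` and turns the difference into a sum.
  let N : ℝ × ℝ →L[ℝ] ℝ × ℝ :=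
    (ContinuousLinearMap.fst ℝ ℝ ℝ).prod (-ContinuousLinearMap.snd ℝ ℝ ℝ)
  have hN : Measurable N := N.continuous.measurable
  have hG : IsGaussian (ν.map N) := inferInstance
  have h := map_fst_add_snd (ν := ν.map N) (ρ := -ρ) ?_ ?_ ?_
  · rw [Measure.map_map (by fun_prop) hN] at h
    rw [show 2 - 2 * ρ = 2 + 2 * -ρ by ring, ← h]
    congr 1
  · rw [Measure.map_map (by fun_prop) hN]
    exact h1
  · rw [Measure.map_map (by fun_prop) hN]
    have : (Prod.snd ∘ N : ℝ × ℝ → ℝ) = (fun x => -x) ∘ Prod.snd := rfl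
    rw [this, ← Measure.map_map (by fun_prop) (by fun_prop), h2, gaussianReal_map_neg, neg_zero]
  · rw [covariance_map (by fun_prop) (by fun_prop) hN.aemeasurable]
    have e1 : (Prod.fst ∘ N : ℝ × ℝ → ℝ) = Prod.fst := rfl
    have e2 : (Prod.snd ∘ N : ℝ × ℝ → ℝ) = -Prod.snd := rfl
    rw [e1, e2, covariance_neg_right, hρ]

end Bivariate

/-- Under a Gaussian copula with correlation `1` the two coordinates coincide; otherwise they are
asymptotically independent at the origin. -/
lemma IsGaussianCopula.eq_or_isLittleO {ρ : ℝ} {C : Measure (ℝ × ℝ)} (hC : IsGaussianCopula ρ C) :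
    (∀ᵐ p ∂C, p.1 = p.2) ∨
      (fun u => C.real {p | p.1 < u ∧ p.2 < u}) =o[𝓝[>] 0] fun u => u := by
  obtain ⟨ν, hν, h1, h2, hρ, rfl⟩ := hC
  have hm : Measurable (Prod.map stdNormalCDF stdNormalCDF) :=
    continuous_stdNormalCDF.measurable.prodMap continuous_stdNormalCDF.measurable
  -- Splitting at `1 ≤ ρ` avoids proving `ρ ≤ 1`: the truncated variance of the difference is then
  -- `0` and the coordinates coincide.
  rcases le_or_gt 1 ρ with h | h
  · left
    have h3 := map_fst_sub_snd h1 h2 hρ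
    rw [Real.toNNReal_of_nonpos (by linarith), gaussianReal_zero_var] at h3
    rw [ae_map_iff hm.aemeasurable (measurableSet_eq_fun measurable_fst measurable_snd)]
    have h4 : ∀ᵐ x ∂ν.map (fun p => p.1 - p.2), x = 0 := by
      rw [h3]
      exact (ae_dirac_iff (measurableSet_singleton (0 : ℝ))).2 rfl
    have h5 := ae_of_ae_map (by fun_prop) h4
    filter_upwards [h5] with p hp
    simp [sub_eq_zero.1 hp]
  · right
    have h3 := map_fst_add_snd h1 h2 hρ
    have hms : ∀ u, (ν.map (Prod.map stdNormalCDF stdNormalCDF)).real {p | p.1 < u ∧ p.2 < u} =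
        ν.real {p | stdNormalCDF p.1 < u ∧ stdNormalCDF p.2 < u} := fun u =>
      map_measureReal_apply hm ((measurableSet_lt measurable_fst measurable_const).inter
        (measurableSet_lt measurable_snd measurable_const))
    simp_rw [hms]
    refine isLittleO_of_gaussian_tail ν (by fun_prop) h3 ?_ fun t p hp => ?_
    · rw [Real.coe_toNNReal']
      exact max_lt (by linarith) (by norm_num)
    · have ha := stdNormalCDF_mono.reflect_lt hp.1
      have hb := stdNormalCDF_mono.reflect_lt hp.2
      show p.1 + p.2 ≤ _
      linarith

/-- Under a Gaussian copula with correlation greater than `-1`, one coordinate near `0` and the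
other near `1` is a negligible event. -/
lemma IsGaussianCopula.isLittleO_opposite {ρ : ℝ} {C : Measure (ℝ × ℝ)}
    (hC : IsGaussianCopula ρ C) (hρ1 : -1 < ρ) :
    ((fun u => C.real {p | p.1 < u ∧ 1 - u < p.2}) =o[𝓝[>] 0] fun u => u) ∧
      (fun u => C.real {p | 1 - u < p.1 ∧ p.2 < u}) =o[𝓝[>] 0] fun u => u := by
  obtain ⟨ν, hν, h1, h2, hρ, rfl⟩ := hC
  have hm : Measurable (Prod.map stdNormalCDF stdNormalCDF) :=
    continuous_stdNormalCDF.measurable.prodMap continuous_stdNormalCDF.measurable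
  have h3 := map_fst_sub_snd h1 h2 hρ
  have h3' : ν.map (fun p => p.2 - p.1) = gaussianReal 0 (2 - 2 * ρ).toNNReal := by
    have := congrArg (Measure.map fun x : ℝ => -x) h3
    rw [gaussianReal_map_neg, neg_zero, Measure.map_map (by fun_prop) (by fun_prop)] at this
    rw [← this]
    congr 1
    ext p
    simp
  have hv : ((2 - 2 * ρ).toNNReal : ℝ) < 4 := by
    rw [Real.coe_toNNReal']
    exact max_lt (by linarith) (by norm_num)
  have hhigh : ∀ t x, 1 - stdNormalCDF (-t) < stdNormalCDF x → t < x := by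
    intro t x h
    rw [stdNormalCDF_neg, sub_sub_cancel] at h
    exact stdNormalCDF_mono.reflect_lt h
  constructor
  · have hms : ∀ u, (ν.map (Prod.map stdNormalCDF stdNormalCDF)).real {p | p.1 < u ∧ 1 - u < p.2} =
        ν.real {p | stdNormalCDF p.1 < u ∧ 1 - u < stdNormalCDF p.2} := fun u =>
      map_measureReal_apply hm ((measurableSet_lt measurable_fst measurable_const).inter
        (measurableSet_lt measurable_const measurable_snd))
    simp_rw [hms]
    refine isLittleO_of_gaussian_tail ν (by fun_prop) h3 hv fun t p hp => ?_
    have ha := stdNormalCDF_mono.reflect_lt hp.1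
    have hb := hhigh _ _ hp.2
    show p.1 - p.2 ≤ _
    linarith
  · have hms : ∀ u, (ν.map (Prod.map stdNormalCDF stdNormalCDF)).real {p | 1 - u < p.1 ∧ p.2 < u} =
        ν.real {p | 1 - u < stdNormalCDF p.1 ∧ stdNormalCDF p.2 < u} := fun u =>
      map_measureReal_apply hm ((measurableSet_lt measurable_const measurable_fst).inter
        (measurableSet_lt measurable_snd measurable_const))
    simp_rw [hms]
    refine isLittleO_of_gaussian_tail ν (by fun_prop) h3' hv fun t p hp => ?_
    have ha := stdNormalCDF_mono.reflect_lt hp.2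
    have hb := hhigh _ _ hp.1
    show p.2 - p.1 ≤ _
    linarith

/-! ### Uniform variables and the tails of the two means -/

section Uniform

variable {Ω : Type*} [MeasurableSpace Ω] {P : Measure Ω} {U : Ω → ℝ}

lemma isStdUniform_iff :
    IsStdUniform P U ↔ Measurable U ∧ P.map U = volume.restrict (Set.Icc 0 1) := by
  unfold IsStdUniform pdf.IsUniform
  simp [ProbabilityTheory.cond]

lemma IsStdUniform.measureReal_preimage (hU : IsStdUniform P U) {s : Set ℝ}
    (hs : MeasurableSet s) : P.real (U ⁻¹' s) = volume.real (s ∩ Set.Icc 0 1) := by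
  obtain ⟨hm, h⟩ := isStdUniform_iff.1 hU
  rw [← map_measureReal_apply hm hs, h, measureReal_restrict_apply hs]

lemma IsStdUniform.measureReal_lt (hU : IsStdUniform P U) {u : ℝ} (h0 : 0 ≤ u) (h1 : u ≤ 1) :
    P.real {ω | U ω < u} = u := by
  have h := hU.measureReal_preimage (s := Set.Iio u) measurableSet_Iio
  have e : Set.Iio u ∩ Set.Icc 0 1 = Set.Ico 0 u := by
    ext x; simp only [Set.mem_inter_iff, Set.mem_Iio, Set.mem_Icc, Set.mem_Ico]
    constructor
    · rintro ⟨h1, h2, h3⟩; exact ⟨h2, h1⟩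
    · rintro ⟨h2, h3⟩; exact ⟨h3, h2, by linarith⟩
  rw [e, Real.volume_real_Ico_of_le h0, sub_zero] at h
  exact h

lemma IsStdUniform.measureReal_le (hU : IsStdUniform P U) {u : ℝ} (h0 : 0 ≤ u) (h1 : u ≤ 1) :
    P.real {ω | U ω ≤ u} = u := by
  have h := hU.measureReal_preimage (s := Set.Iic u) measurableSet_Iic
  have e : Set.Iic u ∩ Set.Icc 0 1 = Set.Icc 0 u := by
    ext x; simp only [Set.mem_inter_iff, Set.mem_Iic, Set.mem_Icc]
    constructor
    · rintro ⟨h1, h2, h3⟩; exact ⟨h2, h1⟩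
    · rintro ⟨h2, h3⟩; exact ⟨h3, h2, by linarith⟩
  rw [e, Real.volume_real_Icc_of_le h0, sub_zero] at h
  exact h

lemma IsStdUniform.ae_mem_Ioo (hU : IsStdUniform P U) : ∀ᵐ ω ∂P, 0 < U ω ∧ U ω < 1 := by
  obtain ⟨hm, h⟩ := isStdUniform_iff.1 hU
  refine ae_of_ae_map (p := fun x : ℝ => 0 < x ∧ x < 1) hm.aemeasurable ?_
  rw [h, ← restrict_Ioo_eq_restrict_Icc]
  exact ae_restrict_mem measurableSet_Ioo

end Uniform

lemma measurable_cauchyQuantile : Measurable cauchyQuantile := by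
  unfold cauchyQuantile
  simp_rw [Real.tan_eq_sin_div_cos]
  fun_prop

lemma continuous_cauchyCDF : Continuous cauchyCDF := by
  unfold cauchyCDF
  fun_prop

lemma tendsto_mul_cauchyCDF_neg :
    Tendsto (fun x : ℝ => x * cauchyCDF (-x)) atTop (𝓝 (Real.pi)⁻¹) := by
  have hp := Real.pi_pos
  have h1 : Tendsto (fun x : ℝ => (Real.pi * x)⁻¹) atTop (𝓝[>] 0) :=
    tendsto_inv_atTop_nhdsGT_zero.comp (tendsto_id.const_mul_atTop hp)
  have h2 := ((tendsto_cauchyCDF_sub_inv_div 0).comp h1).const_mul (Real.pi)⁻¹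
  rw [mul_one] at h2
  refine h2.congr' ?_
  filter_upwards [eventually_gt_atTop 0] with x hx
  have : (Real.pi * (Real.pi * x)⁻¹)⁻¹ = x := by field_simp
  simp only [Function.comp, this, zero_sub]
  field_simp

lemma tendsto_neg_cauchyQuantile : Tendsto (fun p => -cauchyQuantile p) (𝓝[>] 0) atTop := by
  have hp := Real.pi_pos
  have h1 : Tendsto (fun p : ℝ => (Real.pi)⁻¹ * p⁻¹ + -(|cauchyQuantile (1 / 2)| + 1)) (𝓝[>] 0) atTop :=
    tendsto_atTop_add_const_right _ _
      (tendsto_inv_nhdsGT_zero.const_mul_atTop (inv_pos.2 hp))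
  refine tendsto_atTop_mono' _ ?_ h1
  filter_upwards [Ioo_mem_nhdsGT (show (0 : ℝ) < 1 / 2 by norm_num)] with p h
  have := cauchyQuantile_add_inv_le h.1 h.2.le (by norm_num)
  rw [mul_inv] at this
  linarith

/-- The substitution `u = a / x` passes from corner probabilities at scale `u → 0` to tail
conditions at level `x → ∞`. -/
lemma tendsto_mul_comp_div_atTop {f : ℝ → ℝ} (hf : f =o[𝓝[>] 0] fun u => u) {a : ℝ}
    (ha : 0 < a) : Tendsto (fun x => x * f (a / x)) atTop (𝓝 0) := by
  have h1 : Tendsto (fun x : ℝ => a / x) atTop (𝓝[>] 0) := by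
    refine tendsto_nhdsWithin_iff.2 ⟨tendsto_const_nhds.div_atTop tendsto_id, ?_⟩
    filter_upwards [eventually_gt_atTop 0] with x hx using div_pos ha hx
  have h2 := (hf.tendsto_div_nhds_zero.comp h1).const_mul a
  rw [mul_zero] at h2
  refine h2.congr' ?_
  filter_upwards [eventually_gt_atTop 0] with x hx
  simp only [Function.comp]
  field_simp

section Tails

variable {Ω : Type*} [MeasurableSpace Ω] {P : Measure Ω} [IsProbabilityMeasure P] {K : ℕ}
  {U : Fin K → Ω → ℝ}

/-- The harmonic mean of uniform variables which are pairwise almost surely equal or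
asymptotically independent at the origin is asymptotically uniform at the origin. -/
theorem harmonicMean_isEquivalent (hK : 1 ≤ K) (hU : ∀ i, IsStdUniform P (U i))
    (hind : ∀ i j, U i =ᵐ[P] U j ∨
      (fun u => P.real {ω | U i ω < u ∧ U j ω < u}) =o[𝓝[>] 0] fun u => u) :
    (fun ε : ℝ => P.real {ω | harmonicMean (fun i => U i ω) < ε}) ~[𝓝[>] 0] fun ε => ε := by
  have hK' : (0 : ℝ) < K := by exact_mod_cast hK
  have hne : Nonempty (Fin K) := ⟨⟨0, hK⟩⟩
  have hpos : ∀ᵐ ω ∂P, ∀ i, 0 < U i ω := ae_all_iff.2 fun i => (hU i).ae_mem_Ioo.mono fun _ h => h.1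
  -- The reciprocal of a uniform variable has tail exactly `1 / x` for `x ≥ 1`, and the harmonic
  -- mean is below `ε` exactly when the sum of reciprocals exceeds `K / ε`.
  have h1 := tendsto_mul_tail_sum_of_ae_eq_or P (Z := fun i ω => (U i ω)⁻¹)
    (fun i => (hU i).1.inv) (c := 1) ?_ ?_
  · rw [one_mul, Fintype.card_fin] at h1
    have h2 : Tendsto (fun ε : ℝ => K * ε⁻¹) (𝓝[>] 0) atTop :=
      tendsto_inv_nhdsGT_zero.const_mul_atTop hK'
    have h3 := (h1.comp h2).div_const (K : ℝ)
    rw [div_self hK'.ne'] at h3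
    rw [isEquivalent_iff_tendsto_one (by
      filter_upwards [self_mem_nhdsWithin] with ε (h : 0 < ε) using h.ne')]
    refine h3.congr' ?_
    filter_upwards [self_mem_nhdsWithin] with ε (hε : 0 < ε)
    have h4 : P.real {ω | K * ε⁻¹ < ∑ i, (U i ω)⁻¹} =
        P.real {ω | harmonicMean (fun i => U i ω) < ε} := by
      apply measureReal_congr
      filter_upwards [hpos] with ω hω
      have hs := Finset.sum_pos (fun i (_ : i ∈ Finset.univ) => inv_pos.2 (hω i))
        Finset.univ_nonempty
      refine propext (show _ < _ ↔ _ < _ from ?_)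
      rw [harmonicMean_eq hω, inv_lt_comm₀ (by positivity) hε, lt_div_iff₀' hK']
    simp only [Function.comp, Pi.div_apply, h4]
    field_simp
  · intro i
    refine (tendsto_const_nhds (x := (1 : ℝ))).congr' ?_
    filter_upwards [eventually_ge_atTop 1] with x hx
    have hx0 : 0 < x := by linarith
    have h4 : P.real {ω | x < (U i ω)⁻¹} = P.real {ω | U i ω < x⁻¹} := by
      apply measureReal_congr
      filter_upwards [hpos] with ω hω
      refine propext (show _ < _ ↔ _ < _ from ?_)
      rw [lt_inv_comm₀ hx0 (hω i)]
    rw [h4, (hU i).measureReal_lt (by positivity) (inv_le_one_of_one_le₀ hx),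
      mul_inv_cancel₀ hx0.ne']
  · intro i j
    rcases hind i j with h | h
    · left
      filter_upwards [h] with ω hω
      rw [hω]
    right
    intro δ hδ
    refine (tendsto_mul_comp_div_atTop h (inv_pos.2 hδ)).congr' ?_
    filter_upwards [eventually_gt_atTop 0] with x hx
    congr 1
    apply measureReal_congr
    filter_upwards [hpos] with ω hω
    have e : δ⁻¹ / x = (δ * x)⁻¹ := by field_simp
    refine propext (show _ ∧ _ ↔ _ ∧ _ from ?_)
    rw [abs_of_pos (inv_pos.2 (hω j)), e, lt_inv_comm₀ (by positivity) (hω i),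
      lt_inv_comm₀ (by positivity) (hω j)]

/-- The Cauchy combination of uniform variables which are pairwise almost surely equal or
asymptotically independent in all relevant corners is asymptotically uniform at the origin. -/
theorem cauchyMean_isEquivalent (hK : 1 ≤ K) (hU : ∀ i, IsStdUniform P (U i))
    (hind : ∀ i j, U i =ᵐ[P] U j ∨
      ((fun u => P.real {ω | U i ω < u ∧ U j ω < u}) =o[𝓝[>] 0] fun u => u) ∧
      (fun u => P.real {ω | U i ω < u ∧ 1 - u < U j ω}) =o[𝓝[>] 0] fun u => u) :
    (fun ε : ℝ => P.real {ω | cauchyMean (fun i => U i ω) < ε}) ~[𝓝[>] 0] fun ε => ε := by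
  have hp := Real.pi_pos
  have hK' : (0 : ℝ) < K := by exact_mod_cast hK
  have hpos : ∀ᵐ ω ∂P, ∀ i, 0 < U i ω ∧ U i ω < 1 := ae_all_iff.2 fun i => (hU i).ae_mem_Ioo
  -- The negated quantile transform of a uniform variable is standard Cauchy, with tail asymptotic
  -- to `1 / (π x)`.
  have h1 := tendsto_mul_tail_sum_of_ae_eq_or P (Z := fun i ω => -cauchyQuantile (U i ω))
    (fun i => (measurable_cauchyQuantile.comp (hU i).1).neg) (c := (Real.pi)⁻¹) ?_ ?_
  · rw [Fintype.card_fin] at h1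
    have h2 : Tendsto (fun ε : ℝ => K * -cauchyQuantile ε) (𝓝[>] 0) atTop :=
      tendsto_neg_cauchyQuantile.const_mul_atTop hK'
    have h2' := (tendsto_mul_cauchyCDF_neg.comp tendsto_neg_cauchyQuantile).const_mul (K : ℝ)
    have h3 := (h1.comp h2).div h2' (by positivity)
    rw [mul_comm, div_self (by positivity)] at h3
    rw [isEquivalent_iff_tendsto_one (by
      filter_upwards [self_mem_nhdsWithin] with ε (h : 0 < ε) using h.ne')]
    refine h3.congr' ?_
    filter_upwards [Ioo_mem_nhdsGT one_pos, tendsto_neg_cauchyQuantile.eventually_gt_atTop 0]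
      with ε hε hQ
    have h4 : P.real {ω | K * -cauchyQuantile ε < ∑ i, -cauchyQuantile (U i ω)} =
        P.real {ω | cauchyMean (fun i => U i ω) < ε} := by
      apply measureReal_congr
      filter_upwards [hpos] with ω hω
      refine propext (show _ < _ ↔ _ < _ from ?_)
      rw [cauchyMean_eq (fun i => (hω i).1) (fun i => (hω i).2)]
      conv_rhs => rw [← cauchyCDF_cauchyQuantile hε.1 hε.2]
      rw [cauchyCDF_strictMono.lt_iff_lt, div_lt_iff₀' hK', Finset.sum_neg_distrib, mul_neg,
        neg_lt_neg_iff]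
    simp only [Function.comp, Pi.div_apply, h4, neg_neg, cauchyCDF_cauchyQuantile hε.1 hε.2]
    have h5 := hε.1
    have h6 : cauchyQuantile ε ≠ 0 := by linarith
    field_simp
  · intro i
    refine tendsto_mul_cauchyCDF_neg.congr fun x => ?_
    congr 1
    have h4 : P.real {ω | x < -cauchyQuantile (U i ω)} = P.real {ω | U i ω < cauchyCDF (-x)} := by
      apply measureReal_congr
      filter_upwards [hpos] with ω hω
      refine propext (show _ < _ ↔ _ < _ from ?_)
      conv_rhs => rw [← cauchyCDF_cauchyQuantile (hω i).1 (hω i).2]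
      rw [cauchyCDF_strictMono.lt_iff_lt, lt_neg]
    rw [h4, (hU i).measureReal_lt (cauchyCDF_nonneg _) (cauchyCDF_le_one _)]
  · intro i j
    rcases hind i j with h | ⟨h, h'⟩
    · left
      filter_upwards [h] with ω hω
      rw [hω]
    right
    intro δ hδ
    have ha : 0 < (Real.pi * δ)⁻¹ := by positivity
    have h5 := (tendsto_mul_comp_div_atTop h ha).add (tendsto_mul_comp_div_atTop h' ha)
    rw [add_zero] at h5
    refine tendsto_of_tendsto_of_tendsto_of_le_of_le' tendsto_const_nhds h5 ?_ ?_
    · filter_upwards [eventually_ge_atTop 0] with x hx using mul_nonneg hx measureReal_nonneg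
    filter_upwards [eventually_gt_atTop 0] with x hx
    rw [← mul_add]
    gcongr
    refine le_trans ?_ (measureReal_union_le _ _)
    have hlow : ∀ p : ℝ, 0 < p → p < 1 → δ * x < -cauchyQuantile p → p < (Real.pi * δ)⁻¹ / x := by
      intro p h0 h1 h
      have h6 : δ * x < (Real.pi * p)⁻¹ := by linarith [neg_inv_le_cauchyQuantile h0 h1]
      rw [lt_inv_comm₀ (by positivity) (by positivity)] at h6
      have e : (Real.pi * δ)⁻¹ / x = (δ * x)⁻¹ / Real.pi := by field_simp
      rw [e, lt_div_iff₀' hp]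
      exact h6
    refine ENNReal.toReal_mono (measure_ne_top _ _) (measure_mono_ae ?_)
    filter_upwards [hpos] with ω hω
    rintro ⟨h6, h7⟩
    have h8 := hlow _ (hω i).1 (hω i).2 h6
    -- A Cauchy variable is large in absolute value when its uniform variable is near `0` or near
    -- `1`; the second case needs the condition on opposite corners.
    rcases lt_abs.1 h7 with h7 | h7
    · exact Or.inl ⟨h8, hlow _ (hω j).1 (hω j).2 h7⟩
    · refine Or.inr ⟨h8, ?_⟩
      have := hlow (1 - U j ω) (by linarith [(hω j).2]) (by linarith [(hω j).1])
        (by rw [cauchyQuantile_one_sub]; exact h7)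
      linarith

end Tails

/-! ### Transfer of the copula estimates to the pairs `(U i, U j)` -/

section Copula

variable {Ω : Type*} [MeasurableSpace Ω] {P : Measure Ω} {K : ℕ} {U : Fin K → Ω → ℝ}
  {ρ : Fin K → Fin K → ℝ}

lemma PairwiseGaussianCopula.ae_eq_or_isLittleO (hG : PairwiseGaussianCopula P ρ U)
    (hU : ∀ i, Measurable (U i)) (i j : Fin K) :
    U i =ᵐ[P] U j ∨ (fun u => P.real {ω | U i ω < u ∧ U j ω < u}) =o[𝓝[>] 0] fun u => u := by
  have key : ∀ i j, i < j → U i =ᵐ[P] U j ∨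
      (fun u => P.real {ω | U i ω < u ∧ U j ω < u}) =o[𝓝[>] 0] fun u => u := by
    intro i j hij
    have hm : Measurable fun ω => (U i ω, U j ω) := (hU i).prodMk (hU j)
    refine (hG i j hij).eq_or_isLittleO.imp (fun h => ?_) fun h => ?_
    · exact ae_of_ae_map (p := fun p : ℝ × ℝ => p.1 = p.2) hm.aemeasurable h
    refine h.congr_left fun u => ?_
    exact map_measureReal_apply hm ((measurableSet_lt measurable_fst measurable_const).inter
      (measurableSet_lt measurable_snd measurable_const))
  rcases lt_trichotomy i j with h | h | h
  · exact key i j h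
  · exact Or.inl (by rw [h])
  · refine (key j i h).imp (fun h => h.symm) fun h => h.congr_left fun u => ?_
    simp_rw [and_comm]

lemma PairwiseGaussianCopula.isLittleO_opposite (hG : PairwiseGaussianCopula P ρ U)
    (hU : ∀ i, Measurable (U i)) (hρ : ∀ i j, i < j → -1 < ρ i j) {i j : Fin K} (hij : i ≠ j) :
    (fun u => P.real {ω | U i ω < u ∧ 1 - u < U j ω}) =o[𝓝[>] 0] fun u => u := by
  rcases lt_or_gt_of_ne hij with h | h
  · have hm : Measurable fun ω => (U i ω, U j ω) := (hU i).prodMk (hU j)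
    refine ((hG i j h).isLittleO_opposite (hρ i j h)).1.congr_left fun u => ?_
    exact map_measureReal_apply hm ((measurableSet_lt measurable_fst measurable_const).inter
      (measurableSet_lt measurable_const measurable_snd))
  · have hm : Measurable fun ω => (U j ω, U i ω) := (hU j).prodMk (hU i)
    refine ((hG j i h).isLittleO_opposite (hρ j i h)).2.congr_left fun u => ?_
    simp_rw [and_comm (a := U i _ < u)]
    exact map_measureReal_apply hm ((measurableSet_lt measurable_const measurable_fst).inter
      (measurableSet_lt measurable_snd measurable_const))

end Copula

/-! ### Independent uniform variables and quantiles -/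

section Independent

variable {K : ℕ}

instance : IsProbabilityMeasure ((volume : Measure ℝ).restrict (Set.Icc 0 1)) :=
  ⟨by simp⟩

instance : IsProbabilityMeasure (iidUniform K) := by
  unfold iidUniform; infer_instance

lemma isStdUniform_eval (i : Fin K) : IsStdUniform (iidUniform K) (fun p => p i) :=
  isStdUniform_iff.2 ⟨measurable_pi_apply i, (measurePreserving_eval _ i).map_eq⟩

lemma iidUniform_real_inter {i j : Fin K} (hij : i ≠ j) {s t : Set ℝ} (hs : MeasurableSet s)
    (ht : MeasurableSet t) :
    (iidUniform K).real {p | p i ∈ s ∧ p j ∈ t} =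
      volume.real (s ∩ Set.Icc 0 1) * volume.real (t ∩ Set.Icc 0 1) := by
  have h := iIndepFun_pi (μ := fun _ : Fin K => (volume : Measure ℝ).restrict (Set.Icc 0 1))
    (X := fun _ x => x) (fun _ => aemeasurable_id)
  have h2 := (h.indepFun hij).measure_inter_preimage_eq_mul s t hs ht
  rw [← (isStdUniform_eval i).measureReal_preimage hs,
    ← (isStdUniform_eval j).measureReal_preimage ht, measureReal_def, measureReal_def,
    measureReal_def, ← ENNReal.toReal_mul]
  exact congrArg ENNReal.toReal h2

lemma iidUniform_isLittleO {i j : Fin K} (hij : i ≠ j) :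
    ((fun u => (iidUniform K).real {p | p i < u ∧ p j < u}) =o[𝓝[>] 0] fun u => u) ∧
      (fun u => (iidUniform K).real {p | p i < u ∧ 1 - u < p j}) =o[𝓝[>] 0] fun u => u := by
  have hsq : (fun u : ℝ => u * u) =o[𝓝[>] 0] fun u => u := by
    have h : (fun u : ℝ => u) =o[𝓝[>] 0] fun _ => (1 : ℝ) :=
      (isLittleO_one_iff ℝ).2 (tendsto_id.mono_left nhdsWithin_le_nhds)
    simpa using h.mul_isBigO (isBigO_refl (fun u : ℝ => u) (𝓝[>] 0))
  have hlow : ∀ u : ℝ, 0 < u → u < 1 → volume.real (Set.Iio u ∩ Set.Icc 0 1) = u := fun u h0 h1 => by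
    rw [← (isStdUniform_eval i).measureReal_preimage measurableSet_Iio]
    exact (isStdUniform_eval i).measureReal_lt h0.le h1.le
  have hup : ∀ u : ℝ, 0 < u → u < 1 → volume.real (Set.Ioi (1 - u) ∩ Set.Icc 0 1) = u := by
    intro u h0 h1
    have e : Set.Ioi (1 - u) ∩ Set.Icc 0 1 = Set.Ioc (1 - u) 1 := by
      ext x; simp only [Set.mem_inter_iff, Set.mem_Ioi, Set.mem_Icc, Set.mem_Ioc]
      constructor
      · rintro ⟨h1, h2, h3⟩; exact ⟨h1, h3⟩
      · rintro ⟨h2, h3⟩; exact ⟨h2, by linarith, h3⟩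
    rw [e, Real.volume_real_Ioc_of_le (by linarith)]
    ring
  constructor
  · refine hsq.congr' ?_ EventuallyEq.rfl
    filter_upwards [Ioo_mem_nhdsGT one_pos] with u hu
    have h := iidUniform_real_inter hij (s := Set.Iio u) (t := Set.Iio u) measurableSet_Iio
      measurableSet_Iio
    rw [hlow u hu.1 hu.2] at h
    exact h.symm
  · refine hsq.congr' ?_ EventuallyEq.rfl
    filter_upwards [Ioo_mem_nhdsGT one_pos] with u hu
    have h := iidUniform_real_inter hij (s := Set.Iio u) (t := Set.Ioi (1 - u)) measurableSet_Iio
      measurableSet_Ioi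
    rw [hlow u hu.1 hu.2, hup u hu.1 hu.2] at h
    exact h.symm

/-- Quantiles of a variable whose law is asymptotically uniform at the origin. -/
lemma leftQuantile_isEquivalent {Ω : Type*} [MeasurableSpace Ω] (P : Measure Ω)
    [IsProbabilityMeasure P] {X : Ω → ℝ}
    (h : (fun ε : ℝ => P.real {ω | X ω < ε}) ~[𝓝[>] 0] fun ε => ε) :
    (fun ε => leftQuantile P X ε) ~[𝓝[>] 0] fun ε => ε := by
  have hne : ∀ᶠ ε : ℝ in 𝓝[>] 0, ε ≠ 0 := by
    filter_upwards [self_mem_nhdsWithin] with ε (h : 0 < ε) using h.ne'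
  have h1 := (isEquivalent_iff_tendsto_one hne).1 h
  have hscale : ∀ a : ℝ, 0 < a → Tendsto (fun ε : ℝ => a * ε) (𝓝[>] 0) (𝓝[>] 0) := by
    intro a ha
    refine tendsto_nhdsWithin_iff.2 ⟨?_, ?_⟩
    · exact (Continuous.tendsto' (by fun_prop) _ _ (by simp)).mono_left nhdsWithin_le_nhds
    · filter_upwards [self_mem_nhdsWithin] with t (ht : 0 < t) using mul_pos ha ht
  refine isLittleO_iff.2 fun c hc => ?_
  -- The cap `1 / 2` keeps `1 - δ` positive, so both levels `(1 ± δ) ε` tend to `0` from the right.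
  set δ := min c (1 / 2)
  have hδ : 0 < δ := lt_min hc (by norm_num)
  have hδ1 : δ ≤ 1 / 2 := min_le_right _ _
  have h2 := (h1.eventually (lt_mem_nhds (show (1 + δ)⁻¹ < 1 from inv_lt_one_of_one_lt₀
    (by linarith))))
  have h3 := (h1.eventually (gt_mem_nhds (show 1 < (1 - δ)⁻¹ from (one_lt_inv₀
    (by linarith)).2 (by linarith))))
  filter_upwards [(hscale (1 + δ) (by linarith)).eventually h2,
    (hscale (1 - δ) (by linarith)).eventually h3, self_mem_nhdsWithin] with ε h4 h5 (hε : 0 < ε)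
  have ha : 0 < 1 + δ := by linarith
  have hb : 0 < 1 - δ := by linarith
  simp only [Pi.div_apply] at h4 h5
  rw [lt_div_iff₀ (by positivity), inv_mul_cancel_left₀ ha.ne'] at h4
  rw [div_lt_iff₀ (by positivity), inv_mul_cancel_left₀ hb.ne'] at h5
  have hlow : ∀ x ∈ {x : ℝ | ε ≤ P.real {ω | X ω ≤ x}}, (1 - δ) * ε ≤ x := by
    intro x (hx : ε ≤ P.real {ω | X ω ≤ x})
    by_contra! hlt
    have : P.real {ω | X ω ≤ x} ≤ P.real {ω | X ω < (1 - δ) * ε} :=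
      measureReal_mono fun ω (hω : X ω ≤ x) => lt_of_le_of_lt hω hlt
    linarith
  have hmem : (1 + δ) * ε ∈ {x : ℝ | ε ≤ P.real {ω | X ω ≤ x}} := by
    have : P.real {ω | X ω < (1 + δ) * ε} ≤ P.real {ω | X ω ≤ (1 + δ) * ε} :=
      measureReal_mono fun ω (hω : X ω < _) => hω.le
    exact h4.le.trans this
  have h6 : (1 - δ) * ε ≤ leftQuantile P X ε := le_csInf ⟨_, hmem⟩ hlow
  have h7 : leftQuantile P X ε ≤ (1 + δ) * ε := csInf_le ⟨_, hlow⟩ hmem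
  have h8 : δ * ε ≤ c * ε := by gcongr; exact min_le_left _ _
  simp only [Pi.sub_apply, Real.norm_eq_abs, abs_of_pos hε]
  rw [abs_le]
  constructor <;> linarith

theorem thresholdIndep_isEquivalent (hK : 1 ≤ K) :
    (fun ε : ℝ => thresholdIndep (K := K) cauchyMean ε) ~[𝓝[>] 0]
      (fun ε : ℝ => thresholdIndep (K := K) harmonicMean ε) := by
  have hind : ∀ i j : Fin K, (fun p : Fin K → ℝ => p i) =ᵐ[iidUniform K] (fun p => p j) ∨
      ((fun u => (iidUniform K).real {p | p i < u ∧ p j < u}) =o[𝓝[>] 0] fun u => u) ∧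
      (fun u => (iidUniform K).real {p | p i < u ∧ 1 - u < p j}) =o[𝓝[>] 0] fun u => u := by
    intro i j
    rcases eq_or_ne i j with rfl | hij
    · exact Or.inl ae_eq_rfl
    · exact Or.inr (iidUniform_isLittleO hij)
  have h1 := leftQuantile_isEquivalent _ (cauchyMean_isEquivalent hK isStdUniform_eval hind)
  have h2 := leftQuantile_isEquivalent _ (harmonicMean_isEquivalent hK isStdUniform_eval
    fun i j => (hind i j).imp_right And.left)
  exact h1.trans h2.symm

end Independent

/-! ### Arbitrary dependence: rearrangement on an event -/

/-- The probability integral transform for a finite measure without atoms. -/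
lemma map_measureReal_Iic (ν : Measure ℝ) [IsFiniteMeasure ν] [NullSingletonClass ν] :
    ν.map (fun t => ν.real (Set.Iic t)) = volume.restrict (Set.Icc 0 (ν.real Set.univ)) := by
  set G : ℝ → ℝ := fun t => ν.real (Set.Iic t) with hG
  set m := ν.real Set.univ with hm
  have hc : Continuous G := continuous_measureReal_Iic ν
  have hmono : Monotone G := fun s t h => measureReal_mono (Set.Iic_subset_Iic.2 h)
  have hG0 : ∀ t, 0 ≤ G t := fun t => measureReal_nonneg
  have hGm : ∀ t, G t ≤ m := fun t => measureReal_mono (Set.subset_univ _)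
  have htop : Tendsto G atTop (𝓝 m) :=
    (ENNReal.tendsto_toReal (measure_ne_top _ _)).comp (tendsto_measure_Iic_atTop ν)
  have hbot : Tendsto G atBot (𝓝 0) := by
    have h1 : Tendsto (fun t => ν.real (Set.Ici t)) atBot (𝓝 m) :=
      (ENNReal.tendsto_toReal (measure_ne_top _ _)).comp (tendsto_measure_Ici_atBot ν)
    have h2 := h1.const_sub m
    rw [sub_self] at h2
    refine h2.congr fun t => ?_
    have h3 := measureReal_add_measureReal_compl (μ := ν) (measurableSet_Iic (a := t))
    rw [Set.compl_Iic, measureReal_congr (Ioi_ae_eq_Ici (μ := ν) (a := t))] at h3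
    simp only [hG]
    linarith
  refine Measure.ext_of_Iic _ _ fun a => ?_
  rw [Measure.map_apply hc.measurable measurableSet_Iic, Measure.restrict_apply measurableSet_Iic]
  rcases lt_or_ge a 0 with ha | ha
  · have e1 : G ⁻¹' Set.Iic a = ∅ := by
      ext t
      simp only [Set.mem_preimage, Set.mem_Iic, Set.mem_empty_iff_false, iff_false, not_le]
      exact ha.trans_le (hG0 t)
    have e2 : Set.Iic a ∩ Set.Icc 0 m = ∅ := by
      ext t
      simp only [Set.mem_inter_iff, Set.mem_Iic, Set.mem_Icc, Set.mem_empty_iff_false, iff_false]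
      rintro ⟨h1, h2, -⟩
      linarith
    rw [e1, e2, measure_empty, measure_empty]
  rcases le_or_gt m a with hma | hma
  · have e1 : G ⁻¹' Set.Iic a = Set.univ := by
      ext t
      simpa using (hGm t).trans hma
    have e2 : Set.Iic a ∩ Set.Icc 0 m = Set.Icc 0 m :=
      Set.inter_eq_right.2 fun t ht => ht.2.trans hma
    rw [e1, e2, Real.volume_Icc, sub_zero, hm, ofReal_measureReal]
  · have e2 : Set.Iic a ∩ Set.Icc 0 m = Set.Icc 0 a := by
      ext t
      simp only [Set.mem_inter_iff, Set.mem_Iic, Set.mem_Icc]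
      constructor
      · rintro ⟨h1, h2, -⟩; exact ⟨h2, h1⟩
      · rintro ⟨h1, h2⟩; exact ⟨h2, h1, h2.trans hma.le⟩
    rw [e2, Real.volume_Icc, sub_zero]
    rcases (G ⁻¹' Set.Iic a).eq_empty_or_nonempty with he | hne
    · rw [he, measure_empty]
      have : a ≤ 0 := by
        by_contra! hpos
        obtain ⟨s, hs⟩ := (hbot.eventually (gt_mem_nhds hpos)).exists
        exact (he ▸ (show s ∈ G ⁻¹' Set.Iic a from hs.le) : s ∈ (∅ : Set ℝ))
      rw [ENNReal.ofReal_of_nonpos this]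
    · have hbdd : BddAbove (G ⁻¹' Set.Iic a) := by
        obtain ⟨T, hT⟩ := (htop.eventually (lt_mem_nhds hma)).exists
        refine ⟨T, fun s (hs : G s ≤ a) => ?_⟩
        by_contra! hlt
        linarith [hmono hlt.le]
      -- By monotonicity and continuity the preimage is `Iic s` with `G s = a`, so its mass is `a`
      -- by the definition of `G`.
      set s := sSup (G ⁻¹' Set.Iic a)
      have hs : G s ≤ a := (isClosed_Iic.preimage hc).csSup_mem hne hbdd
      have hset : G ⁻¹' Set.Iic a = Set.Iic s := by
        ext t
        exact ⟨fun ht => le_csSup hbdd ht, fun ht => (hmono ht).trans hs⟩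
      have hsa : a ≤ G s := by
        refine ge_of_tendsto ((hc.tendsto s).mono_left (nhdsWithin_le_nhds (s := Set.Ioi s))) ?_
        filter_upwards [self_mem_nhdsWithin] with t (ht : s < t)
        by_contra! hlt
        exact absurd (le_csSup hbdd (show t ∈ G ⁻¹' Set.Iic a from hlt.le)) (not_le.2 ht)
      rw [hset, le_antisymm hsa hs, ofReal_measureReal]

section Rearrangement

variable {Ω : Type*} [MeasurableSpace Ω] {P : Measure Ω} {K : ℕ}

lemma IsStdUniform.nullSingletonClass_map_restrict {U : Ω → ℝ} (hU : IsStdUniform P U)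
    (A : Set Ω) : NullSingletonClass ((P.restrict A).map U) := by
  refine ⟨fun x => ?_⟩
  have h : (P.restrict A).map U ≤ P.map U := Measure.map_mono Measure.restrict_le_self hU.1
  refine le_antisymm ((h _).trans ?_) bot_le
  rw [(isStdUniform_iff.1 hU).2]
  simp

lemma leftQuantile_nonneg {X : Ω → ℝ} (hX : ∀ᵐ ω ∂P, 0 ≤ X ω) {ε : ℝ} (hε : 0 < ε) :
    ∀ x ∈ {x : ℝ | ε ≤ P.real {ω | X ω ≤ x}}, 0 ≤ x := by
  intro x (hx : ε ≤ P.real {ω | X ω ≤ x})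
  by_contra! hlt
  have : P {ω | X ω ≤ x} = 0 := by
    refine measure_mono_null (fun ω (hω : X ω ≤ x) => ?_) hX
    simp only [Set.mem_ofPred_eq, Set.mem_compl_iff]
    linarith
  rw [measureReal_def, this, ENNReal.toReal_zero] at hx
  linarith

lemma aemeasurable_cauchyMean {U : Fin K → Ω → ℝ} (hU : ∀ i, IsStdUniform P (U i)) :
    AEMeasurable (fun ω => cauchyMean (fun i => U i ω)) P := by
  refine ⟨fun ω => cauchyCDF ((∑ i, cauchyQuantile (U i ω)) / K), ?_, ?_⟩
  · exact continuous_cauchyCDF.measurable.comp ((Finset.measurable_fun_sum _ fun i _ =>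
      measurable_cauchyQuantile.comp (hU i).1).div_const _)
  · filter_upwards [ae_all_iff.2 fun i => (hU i).ae_mem_Ioo] with ω hω
    exact cauchyMean_eq (fun i => (hω i).1) fun i => (hω i).2

lemma aemeasurable_harmonicMean {U : Fin K → Ω → ℝ} (hU : ∀ i, IsStdUniform P (U i)) :
    AEMeasurable (fun ω => harmonicMean (fun i => U i ω)) P := by
  refine ⟨fun ω => ((∑ i, (U i ω)⁻¹) / K)⁻¹, ?_, ?_⟩
  · exact ((Finset.measurable_fun_sum _ fun i _ => (hU i).1.inv).div_const _).inv
  · filter_upwards [ae_all_iff.2 fun i => (hU i).ae_mem_Ioo] with ω hω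
    exact harmonicMean_eq fun i => (hω i).1

/-- Supplies the lower bound without which `sInf` on the reals would take its default value. -/
lemma thresholdArbitrary_nonneg {F : (Fin K → ℝ) → ℝ} (hF : ∀ p, (∀ i, 0 < p i) → 0 ≤ F p)
    {ε : ℝ} (hε : 0 < ε) :
    ∀ q ∈ {q : ℝ | ∃ U : Fin K → Ω → ℝ, (∀ i, IsStdUniform P (U i)) ∧
      q = leftQuantile P (fun ω => F (fun i => U i ω)) ε}, 0 ≤ q := by
  rintro q ⟨U, hU, rfl⟩
  refine Real.sInf_nonneg (leftQuantile_nonneg ?_ hε)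
  filter_upwards [ae_all_iff.2 fun i => (hU i).ae_mem_Ioo] with ω hω
  exact hF _ fun i => (hω i).1

variable [IsProbabilityMeasure P]

open Classical in
/-- Rank a uniform variable separately on an event and on its complement, placing the values on the
event below those on the complement. -/
noncomputable def rearrange (P : Measure Ω) (A : Set Ω) (U : Ω → ℝ) (ω : Ω) : ℝ :=
  if ω ∈ A then ((P.restrict A).map U).real (Set.Iic (U ω))
  else P.real A + ((P.restrict Aᶜ).map U).real (Set.Iic (U ω))

/-- By the integral transform the ranks on `A` fill `[0, P A]` uniformly and those on the
complement, shifted by `P A`, fill `[P A, 1]`; the two pieces add up to Lebesgue measure on `[0,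
1]`. -/
lemma IsStdUniform.rearrange {U : Ω → ℝ} (hU : IsStdUniform P U) {A : Set Ω}
    (hA : MeasurableSet A) : IsStdUniform P (rearrange P A U) := by
  have h1 := hU.nullSingletonClass_map_restrict A
  have h2 := hU.nullSingletonClass_map_restrict Aᶜ
  set G := fun t => ((P.restrict A).map U).real (Set.Iic t) with hG
  set G' := fun t => ((P.restrict Aᶜ).map U).real (Set.Iic t) with hG'
  have hGm : Measurable G := (continuous_measureReal_Iic _).measurable
  have hGm' : Measurable G' := (continuous_measureReal_Iic _).measurable
  have hm : Measurable (PValueMerging.rearrange P A U) :=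
    Measurable.ite hA (hGm.comp hU.1) ((hGm'.comp hU.1).const_add _)
  refine isStdUniform_iff.2 ⟨hm, ?_⟩
  have hmass : ∀ B : Set Ω, MeasurableSet B → ((P.restrict B).map U).real Set.univ = P.real B := by
    intro B hB
    rw [map_measureReal_apply hU.1 MeasurableSet.univ, Set.preimage_univ,
      measureReal_restrict_apply MeasurableSet.univ, Set.univ_inter]
  have e1 : (P.restrict A).map (PValueMerging.rearrange P A U) =
      volume.restrict (Set.Icc 0 (P.real A)) := by
    have : PValueMerging.rearrange P A U =ᵐ[P.restrict A] G ∘ U := by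
      filter_upwards [ae_restrict_mem hA] with ω hω
      simp [PValueMerging.rearrange, hω, hG]
    rw [Measure.map_congr this, ← Measure.map_map hGm hU.1, hG, map_measureReal_Iic, hmass A hA]
  have e2 : (P.restrict Aᶜ).map (PValueMerging.rearrange P A U) =
      volume.restrict (Set.Icc (P.real A) 1) := by
    have : PValueMerging.rearrange P A U =ᵐ[P.restrict Aᶜ] (fun x => P.real A + x) ∘ G' ∘ U := by
      filter_upwards [ae_restrict_mem hA.compl] with ω hω
      simp [PValueMerging.rearrange, (show ω ∉ A from hω), hG']
    rw [Measure.map_congr this, ← Measure.map_map (by fun_prop) (hGm'.comp hU.1),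
      ← Measure.map_map hGm' hU.1, hG', map_measureReal_Iic, hmass Aᶜ hA.compl,
      probReal_compl_eq_one_sub hA]
    have := (measurePreserving_add_left (volume : Measure ℝ) (P.real A)).restrict_preimage
      (measurableSet_Icc (a := P.real A) (b := 1))
    rw [Set.preimage_const_add_Icc, sub_self] at this
    exact this.map_eq
  have hA1 : P.real A ≤ 1 := measureReal_le_one
  have hsplit : P.map (PValueMerging.rearrange P A U) =
      (P.restrict A).map (PValueMerging.rearrange P A U) +
        (P.restrict Aᶜ).map (PValueMerging.rearrange P A U) := by
    rw [← Measure.map_add _ _ hm, Measure.restrict_add_restrict_compl hA]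
  rw [hsplit, e1, e2, ← Set.Ico_union_Icc_eq_Icc (measureReal_nonneg (μ := P) (s := A)) hA1,
    Measure.restrict_union _ measurableSet_Icc, restrict_Ico_eq_restrict_Icc]
  exact Set.disjoint_left.2 fun x hx hx' => absurd hx.2 (not_lt.2 hx'.1)

lemma rearrange_le_measureReal {U : Ω → ℝ} (hU : Measurable U) {A : Set Ω} {ω : Ω} (hω : ω ∈ A) :
    rearrange P A U ω ≤ P.real A := by
  rw [rearrange, if_pos hω, map_measureReal_apply hU measurableSet_Iic,
    measureReal_restrict_apply (hU measurableSet_Iic)]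
  exact measureReal_mono Set.inter_subset_right

/-- On `A` the new value is `P (A ∩ {U ≤ u})` at `u = U ω`, and `P {U ≤ u} = u`. -/
lemma IsStdUniform.rearrange_le {U : Ω → ℝ} (hU : IsStdUniform P U) {A : Set Ω} {ω : Ω}
    (hω : ω ∈ A) (h0 : 0 ≤ U ω) (h1 : U ω ≤ 1) : PValueMerging.rearrange P A U ω ≤ U ω := by
  rw [PValueMerging.rearrange, if_pos hω, map_measureReal_apply hU.1 measurableSet_Iic,
    measureReal_restrict_apply (hU.1 measurableSet_Iic)]
  conv_rhs => rw [← hU.measureReal_le h0 h1]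
  exact measureReal_mono Set.inter_subset_left

/-- On a space carrying a uniform variable, events have subevents of every smaller probability. -/
lemma IsStdUniform.exists_subset_measureReal_eq {U : Ω → ℝ} (hU : IsStdUniform P U) {A : Set Ω}
    (hA : MeasurableSet A) {ε : ℝ} (h0 : 0 < ε) (h : ε ≤ P.real A) :
    ∃ B ⊆ A, MeasurableSet B ∧ P.real B = ε := by
  have hn := hU.nullSingletonClass_map_restrict A
  have hval : ∀ t, ((P.restrict A).map U).real (Set.Iic t) = P.real (U ⁻¹' Set.Iic t ∩ A) :=
    fun t => by rw [map_measureReal_apply hU.1 measurableSet_Iic,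
      measureReal_restrict_apply (hU.1 measurableSet_Iic)]
  have hc := continuous_measureReal_Iic ((P.restrict A).map U)
  have hlow : ((P.restrict A).map U).real (Set.Iic 0) ≤ ε := by
    rw [hval]
    refine (measureReal_mono Set.inter_subset_left).trans ?_
    have := hU.measureReal_le le_rfl zero_le_one
    exact (show P.real (U ⁻¹' Set.Iic 0) = 0 from this).le.trans h0.le
  have hup : ε ≤ ((P.restrict A).map U).real (Set.Iic 1) := by
    rw [hval]
    refine h.trans (ENNReal.toReal_mono (measure_ne_top _ _) (measure_mono_ae ?_))
    filter_upwards [hU.ae_mem_Ioo] with ω hω hωA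
    exact ⟨hω.2.le, hωA⟩
  obtain ⟨t, ht⟩ := mem_range_of_exists_le_of_exists_ge hc ⟨0, hlow⟩ ⟨1, hup⟩
  exact ⟨U ⁻¹' Set.Iic t ∩ A, Set.inter_subset_right, (hU.1 measurableSet_Iic).inter hA,
    (hval t).symm.trans ht⟩

/-- If `F₂ ≤ c F₁` near the origin, then the thresholds of `F₂` under arbitrary dependence are at
most `c` times those of `F₁` at small levels. -/
lemma thresholdArbitrary_le_mul (hK : 1 ≤ K) {F₁ F₂ : (Fin K → ℝ) → ℝ}
    (hmono : ∀ p q : Fin K → ℝ, (∀ i, 0 < p i) → (∀ i, p i ≤ q i) → (∀ i, q i < 1) → F₁ p ≤ F₁ q)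
    (hmeas : ∀ U : Fin K → Ω → ℝ, (∀ i, IsStdUniform P (U i)) →
      AEMeasurable (fun ω => F₁ (fun i => U i ω)) P)
    (hone : ∀ p : Fin K → ℝ, (∀ i, 0 < p i) → (∀ i, p i < 1) → F₁ p ≤ 1)
    (hpos : ∀ p : Fin K → ℝ, (∀ i, 0 < p i) → 0 ≤ F₂ p) {c : ℝ} (hc : 0 < c) {ε : ℝ}
    (hε0 : 0 < ε) (hε1 : ε ≤ 1)
    (hcmp : ∀ p : Fin K → ℝ, (∀ i, 0 < p i) → (∀ i, p i ≤ ε) → F₂ p ≤ c * F₁ p) :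
    thresholdArbitrary P F₂ ε ≤ c * thresholdArbitrary P F₁ ε := by
  -- If no uniform variable exists, both thresholds are the infimum of the empty set, which is `0`.
  rcases Set.eq_empty_or_nonempty {U : Ω → ℝ | IsStdUniform P U} with he | ⟨U₀, hU₀⟩
  · have h : ∀ F : (Fin K → ℝ) → ℝ, thresholdArbitrary P F ε = 0 := by
      intro F
      have : {q : ℝ | ∃ U : Fin K → Ω → ℝ, (∀ i, IsStdUniform P (U i)) ∧
          q = leftQuantile P (fun ω => F (fun i => U i ω)) ε} = ∅ := by
        refine Set.eq_empty_of_forall_notMem ?_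
        rintro q ⟨U, hU, -⟩
        exact Set.eq_empty_iff_forall_notMem.1 he _ (hU ⟨0, hK⟩)
      rw [thresholdArbitrary, this, Real.sInf_empty]
    simp [h]
  rw [← inv_mul_le_iff₀ hc]
  refine le_csInf ⟨_, fun _ => U₀, fun _ => hU₀, rfl⟩ ?_
  rintro q ⟨U, hU, rfl⟩
  have hgood : ∀ᵐ ω ∂P, ∀ i, 0 < U i ω ∧ U i ω < 1 := ae_all_iff.2 fun i => (hU i).ae_mem_Ioo
  refine le_csInf ⟨1, ?_⟩ ?_
  · have : P.real {ω | F₁ (fun i => U i ω) ≤ 1} = 1 := by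
      rw [measureReal_congr (t := Set.univ), probReal_univ]
      refine eventuallyEq_univ.2 ?_
      filter_upwards [hgood] with ω hω
      exact hone _ (fun i => (hω i).1) fun i => (hω i).2
    exact hε1.trans this.ge
  intro x (hx : ε ≤ P.real {ω | F₁ (fun i => U i ω) ≤ x})
  rw [inv_mul_le_iff₀ hc]
  have hnull : NullMeasurableSet {ω | F₁ (fun i => U i ω) ≤ x} P :=
    nullMeasurableSet_le (hmeas U hU) aemeasurable_const
  -- The sublevel event is only null measurable; it is replaced by a measurable subset, then by one
  -- of probability exactly `ε`, so that the rearranged values on it are at most `ε`.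
  obtain ⟨A, hAsub, hA, hAe⟩ := hnull.exists_measurable_subset_ae_eq
  rw [← measureReal_congr hAe] at hx
  obtain ⟨B, hBsub, hB, hBe⟩ := (hU ⟨0, hK⟩).exists_subset_measureReal_eq hA hε0 hx
  have hV : ∀ i, IsStdUniform P (rearrange P B (U i)) := fun i => (hU i).rearrange hB
  have hVpos : ∀ᵐ ω ∂P, ∀ i, 0 < rearrange P B (U i) ω :=
    ae_all_iff.2 fun i => (hV i).ae_mem_Ioo.mono fun _ h => h.1
  have hmem : ε ≤ P.real {ω | F₂ (fun i => rearrange P B (U i) ω) ≤ c * x} := by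
    rw [← hBe]
    refine ENNReal.toReal_mono (measure_ne_top _ _) (measure_mono_ae ?_)
    filter_upwards [hgood, hVpos] with ω h1 h2 hω
    calc F₂ (fun i => rearrange P B (U i) ω)
        ≤ c * F₁ (fun i => rearrange P B (U i) ω) :=
          hcmp _ h2 fun i => (rearrange_le_measureReal (hU i).1 hω).trans hBe.le
      _ ≤ c * F₁ (fun i => U i ω) := by
          refine mul_le_mul_of_nonneg_left (hmono _ _ h2 (fun i => ?_) fun i => (h1 i).2) hc.le
          exact (hU i).rearrange_le hω (h1 i).1.le (h1 i).2.le
      _ ≤ c * x := mul_le_mul_of_nonneg_left (hAsub (hBsub hω)) hc.le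
  calc thresholdArbitrary P F₂ ε
      ≤ leftQuantile P (fun ω => F₂ (fun i => rearrange P B (U i) ω)) ε :=
        csInf_le ⟨0, thresholdArbitrary_nonneg hpos hε0⟩ ⟨_, hV, rfl⟩
    _ ≤ c * x := csInf_le ⟨0, leftQuantile_nonneg (hVpos.mono fun ω h => hpos _ h) hε0⟩ hmem

lemma harmonicMean_le_one (hK : 1 ≤ K) {p : Fin K → ℝ} (h0 : ∀ i, 0 < p i) (h1 : ∀ i, p i < 1) :
    harmonicMean p ≤ 1 := by
  refine (harmonicMean_mono hK h0 fun i => (h1 i).le).trans ?_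
  have hK' : (K : ℝ) ≠ 0 := by positivity
  rw [harmonicMean_eq fun _ => one_pos]
  simp [hK']

lemma cauchyMean_le_one {p : Fin K → ℝ} (h0 : ∀ i, 0 < p i) (h1 : ∀ i, p i < 1) :
    cauchyMean p ≤ 1 := by
  rw [cauchyMean_eq h0 h1]
  exact cauchyCDF_le_one _

/-- Part (i) with `c = 1 / 2` in uniform form: if all coordinates are at most a small `ε`, then so
is their minimum, and the ratio is close to `1`. -/
lemma cauchyMean_harmonicMean_compare (hK : 1 ≤ K) {c : ℝ} (hc : 1 < c) :
    ∀ᶠ ε : ℝ in 𝓝[>] 0, ∀ p : Fin K → ℝ, (∀ i, 0 < p i) → (∀ i, p i ≤ ε) →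
      cauchyMean p ≤ c * harmonicMean p ∧ harmonicMean p ≤ c * cauchyMean p := by
  have hne : Nonempty (Fin K) := ⟨⟨0, hK⟩⟩
  have h := tendsto_cauchyMean_div_harmonicMean hK (show (1 / 2 : ℝ) < 1 by norm_num)
  have h1 := (h.eventually (gt_mem_nhds hc)).and
    (h.eventually (lt_mem_nhds (inv_lt_one_of_one_lt₀ hc)))
  rw [eventually_inf_principal, eventually_comap] at h1
  obtain ⟨δ, hδ, hsub⟩ := mem_nhdsGT_iff_exists_Ioo_subset.1 h1
  filter_upwards [Ioo_mem_nhdsGT (lt_min (show (0 : ℝ) < δ from hδ) (show (0 : ℝ) < 1 / 2 by norm_num))]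
    with ε hε p hp0 hpε
  obtain ⟨i, hi⟩ := exists_eq_ciInf_of_finite (f := p)
  have hmem : (⨅ i, p i) ∈ Set.Ioo 0 δ := by
    rw [← hi]
    exact ⟨hp0 i, (hpε i).trans_lt (hε.2.trans_le (min_le_left _ _))⟩
  have hH := harmonicMean_pos hK hp0
  obtain ⟨h2, h3⟩ := hsub hmem p rfl
    fun i => (hpε i).trans (hε.2.le.trans (min_le_right _ _))
  rw [div_lt_iff₀ hH] at h2
  rw [lt_div_iff₀ hH, inv_mul_lt_iff₀ (by linarith)] at h3
  exact ⟨h2.le, h3.le⟩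

theorem thresholdArbitrary_isEquivalent (P : Measure Ω) [IsProbabilityMeasure P] (hK : 1 ≤ K) :
    (fun ε : ℝ => thresholdArbitrary P (K := K) cauchyMean ε) ~[𝓝[>] 0]
      (fun ε : ℝ => thresholdArbitrary P (K := K) harmonicMean ε) := by
  refine isLittleO_iff.2 fun η hη => ?_
  filter_upwards [cauchyMean_harmonicMean_compare hK (show 1 < 1 + η by linarith),
    Ioo_mem_nhdsGT one_pos] with ε h hε
  have hc : 0 < 1 + η := by linarith
  have h1 := thresholdArbitrary_le_mul (P := P) hK (F₁ := harmonicMean) (F₂ := cauchyMean)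
    (fun p q h0 h _ => harmonicMean_mono hK h0 h) (fun U hU => aemeasurable_harmonicMean hU)
    (fun p h0 h1 => harmonicMean_le_one hK h0 h1) (fun p _ => cauchyMean_nonneg p) hc hε.1 hε.2.le
    fun p h0 hp => (h p h0 hp).1
  have h2 := thresholdArbitrary_le_mul (P := P) hK (F₁ := cauchyMean) (F₂ := harmonicMean)
    (fun p q h0 h h1 => cauchyMean_mono h0 h h1) (fun U hU => aemeasurable_cauchyMean hU)
    (fun p h0 h1 => cauchyMean_le_one h0 h1) (fun p h0 => (harmonicMean_pos hK h0).le) hc hε.1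
    hε.2.le fun p h0 hp => (h p h0 hp).2
  have h3 : 0 ≤ thresholdArbitrary P (K := K) harmonicMean ε :=
    Real.sInf_nonneg (thresholdArbitrary_nonneg (fun p h0 => (harmonicMean_pos hK h0).le) hε.1)
  simp only [Pi.sub_apply, Real.norm_eq_abs, abs_of_nonneg h3]
  rw [abs_le]
  constructor <;> nlinarith

end Rearrangement

end PValueMerging

theorem mainTheorem2 {Ω : Type*} [MeasurableSpace Ω] (P : Measure Ω) [IsProbabilityMeasure P]
    (hP : PValueMerging.IsAtomless P) (K : ℕ) (hK : 1 ≤ K) :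
    -- (i)
    (∀ c : ℝ, 0 < c → c < 1 →
      Tendsto (fun p : Fin K → ℝ => PValueMerging.cauchyMean p / PValueMerging.harmonicMean p)
        (comap (fun p => ⨅ i, p i) (𝓝[>] 0) ⊓ 𝓟 {p | ∀ i, p i ≤ c}) (𝓝 1)) ∧
    -- (ii)
    (∀ (U : Fin K → Ω → ℝ) (ρ : Fin K → Fin K → ℝ),
      (∀ i, PValueMerging.IsStdUniform P (U i)) → PValueMerging.PairwiseGaussianCopula P ρ U →
      ((fun ε : ℝ => P.real {ω | PValueMerging.harmonicMean (fun i => U i ω) < ε}) ~[𝓝[>] 0]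
        (fun ε : ℝ => ε)) ∧
      ((∀ i j, i < j → -1 < ρ i j) →
        ((fun ε : ℝ => P.real {ω | PValueMerging.cauchyMean (fun i => U i ω) < ε}) ~[𝓝[>] 0]
          (fun ε : ℝ => P.real {ω | PValueMerging.harmonicMean (fun i => U i ω) < ε})) ∧
        ((fun ε : ℝ => P.real {ω | PValueMerging.cauchyMean (fun i => U i ω) < ε}) ~[𝓝[>] 0]
          (fun ε : ℝ => ε)))) ∧
    ((fun ε : ℝ => PValueMerging.thresholdIndep (K := K) PValueMerging.cauchyMean ε) ~[𝓝[>] 0]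
      (fun ε : ℝ => PValueMerging.thresholdIndep (K := K) PValueMerging.harmonicMean ε)) ∧
    -- (iii)
    ((fun ε : ℝ =>
        PValueMerging.thresholdArbitrary P (K := K) PValueMerging.cauchyMean ε) ~[𝓝[>] 0]
      (fun ε : ℝ =>
        PValueMerging.thresholdArbitrary P (K := K) PValueMerging.harmonicMean ε)) ∧
    -- (iv)
    (2 ≤ K → ∀ r : EReal, r ≠ -1 →
      ¬ Tendsto (fun p : Fin K → ℝ => PValueMerging.cauchyMean p / PValueMerging.powerMean r p)
        (comap (fun p => ⨆ i, p i) (𝓝[>] 0) ⊓ 𝓟 {p | ∀ i, 0 < p i}) (𝓝 1)) := by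
  refine ⟨fun c _ hc => PValueMerging.tendsto_cauchyMean_div_harmonicMean hK hc, ?_,
    PValueMerging.thresholdIndep_isEquivalent hK,
    PValueMerging.thresholdArbitrary_isEquivalent P hK, ?_⟩
  · intro U ρ hU hG
    have hm : ∀ i, Measurable (U i) := fun i => (hU i).1
    have hH := PValueMerging.harmonicMean_isEquivalent hK hU (hG.ae_eq_or_isLittleO hm)
    refine ⟨hH, fun hρ => ?_⟩
    have hC := PValueMerging.cauchyMean_isEquivalent hK hU fun i j => by
      rcases eq_or_ne i j with rfl | hij
      · exact Or.inl ae_eq_rfl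
      · exact (hG.ae_eq_or_isLittleO hm i j).imp_right
          fun h => ⟨h, hG.isLittleO_opposite hm hρ hij⟩
    exact ⟨hC.trans hH.symm, hC⟩
  · intro hK2 r hr h
    obtain ⟨v, hv, hne⟩ := PValueMerging.exists_powerMean_ne_harmonicMean hK2 hr
    exact hne (PValueMerging.powerMean_eq_harmonicMean_of_tendsto hK r h hv)
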